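/- **Setting.** Let $\mathcal S\subset\mathbb Z^2$ be a finite step set, with step polynomial $S(x,y)=\sum_{(i,j)\in\mathcal S}x^iy^j$. Let $\overline{\mathbb K}$ be an algebraic closure of $\mathbb K=\mathbb C(x,y)$. Two distinct pairs $\mathbf u,\mathbf v\in(\overline{\mathbb K}\setminus\{0\})^2$ are *adjacent* if they differ in only one coordinate and $S(\mathbf u)=S(\mathbf v)$. The *orbit of $\mathcal S$* is the class of $(x,y)$ for the reflexive and transitive closure of this relation. If $S$ has a unique critical point $(a,b)$ with $a,b>0$ (that is, $S_x(a,b)=S_y(a,b)=0$), and if $S_{xx}(a,b)>0$ and $S_{yy}(a,b)>0$, the *excursion exponent* of $\mathcal S$ is $$\alpha=-1-\frac{\pi}{\arccos(-c)},\qquad c=\frac{S_{xy}(a,b)}{\sqrt{S_{xx}(a,b)\,S_{yy}(a,b)}}.$$ **Proposition.** Consider the following sixteen step sets in $\{-2,-1,0,1\}^2$ (where $ij$ stands for the step $(i,j)$, and $\bar k$ for $-k$): | # | steps | $\alpha$ | |---|---|---| | 1 | $\bar21,\ 01,\ 1\bar2$ | $-5$ | | 2 | $\bar21,\ 1\bar2,\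 11$ | $-4$ | | 3 | $\bar21,\ 1\bar1,\ 10$ | $-7$ | | 4 | $\bar21,\ 1\bar1,\ 11$ | $-5$ | | 5 | $\bar2\bar1,\ 1\bar1,\ 11$ | $-7/3$ | | 6 | $\bar2\bar1,\ 10,\ 11$ | $-11/5$ | | 7 | $\bar21,\ \bar11,\ 01,\ 1\bar1$ | $-7$ | | 8 | $\bar2\bar1,\ \bar1\bar1,\ 0\bar1,\ 11$ | $-11/5$ | | 9 | $\bar2\bar2,\ \bar20,\ 10,\ 11$ | $-7/3$ | | 10 | $\bar2\bar2,\ \bar20,\ \bar1\bar1,\ \bar10,\ 10,\ 11$ | $-7/3$ | | 11 | $\bar2\bar1,\ \bar1\bar1,\ 0\bar1,\ 01,\ 1\bar1,\ 11$ | $-5/2$ | | 12 | $\bar21,\ \bar11,\ 0\bar1,\ 01,\ 1\bar1,\ 11$ | $-4$ | | 13 | $\bar21,\ \bar10,\ 0\bar1,\ 01,\ 1\bar2,\ 10$ | $-4$ | | 14 | $\bar21,\ \bar10,\ 01,\ 1\bar2,\ 1\bar1,\ 11$ | $-4$ | | 15 | $\bar2\bar1,\ \bar11,\ 01,\ 1\bar2,\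 10,\ 11$ | $-3$ | | 16 | $\bar21,\ \bar10,\ \bar11,\ 0\bar1,\ 01,\ 1\bar2,\ 1\bar1,\ 10,\ 11$ | $-4$ | For each of these sixteen models, the step polynomial has a unique critical point in $\mathbb R_{>0}^2$, both $S_{xx}$ and $S_{yy}$ are positive there, and the excursion exponent is the rational number $\alpha$ given in the table. Nevertheless, the orbit of each of these sixteen models is infinite. -/

import Mathlib

namespace LatticeWalk

/-- The value at the point `u` of the step polynomial (a Laurent polynomial)
`S(x₁, …, x_d) = ∑ s ∈ S, x₁ ^ s₁ ⋯ x_d ^ s_d` of a finite step set `S ⊂ ℤ^d`. -/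
def stepPoly {d : ℕ} {F : Type*} [Field F] (S : Finset (Fin d → ℤ)) (u : Fin d → F) : F :=
  ∑ s ∈ S, ∏ i, u i ^ s i

/-- `u` and `v` are `i`-adjacent: they are distinct `d`-tuples of nonzero elements that differ
only by their `i`-th coordinate, and the step polynomial takes the same value at both. -/
def AdjacentAt {d : ℕ} {F : Type*} [Field F] (S : Finset (Fin d → ℤ)) (i : Fin d)
    (u v : Fin d → F) : Prop :=
  (∀ j, u j ≠ 0) ∧ (∀ j, v j ≠ 0) ∧ u ≠ v ∧ (∀ j, j ≠ i → u j = v j) ∧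
    stepPoly S u = stepPoly S v

/-- `u` and `v` are adjacent if they are `i`-adjacent for some `i`. -/
def Adjacent {d : ℕ} {F : Type*} [Field F] (S : Finset (Fin d → ℤ)) (u v : Fin d → F) : Prop :=
  ∃ i, AdjacentAt S i u v

/-- The orbit of `u`: its class under the reflexive and transitive closure of the (symmetric)
adjacency relation. -/
def orbitOf {d : ℕ} {F : Type*} [Field F] (S : Finset (Fin d → ℤ)) (u : Fin d → F) :
    Set (Fin d → F) :=
  {v | Relation.ReflTransGen (Adjacent S) u v}

/-- The field `ℂ(x₁, …, x_d)` of rational functions. -/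
abbrev RationalFunctions (d : ℕ) : Type := FractionRing (MvPolynomial (Fin d) ℂ)

/-- The point `(x₁, …, x_d)` with coordinates the indeterminates, over an extension `L` of
`ℂ(x₁, …, x_d)`. -/
noncomputable def genericPoint (d : ℕ) (L : Type*) [Field L] [Algebra (RationalFunctions d) L] :
    Fin d → L :=
  fun i => algebraMap (RationalFunctions d) L
    (algebraMap (MvPolynomial (Fin d) ℂ) (RationalFunctions d) (MvPolynomial.X i))

/-- The partial derivative `∂f/∂x_i` of a real function of `d` real variables. -/
noncomputable def partialDeriv {d : ℕ} (i : Fin d) (f : (Fin d → ℝ) → ℝ) (p : Fin d → ℝ) : ℝ :=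
  deriv (fun t : ℝ => f (Function.update p i t)) (p i)

/-- `p` is a critical point, with positive coordinates, of the step polynomial of `S`. -/
def IsPositiveCriticalPoint {d : ℕ} (S : Finset (Fin d → ℤ)) (p : Fin d → ℝ) : Prop :=
  (∀ i, 0 < p i) ∧ ∀ i, partialDeriv i (stepPoly S) p = 0

/-- The second partial derivative `∂²S/∂x_i∂x_j` of the step polynomial at `p`. -/
noncomputable def secondDeriv {d : ℕ} (S : Finset (Fin d → ℤ)) (i j : Fin d)
    (p : Fin d → ℝ) : ℝ :=
  partialDeriv i (partialDeriv j (stepPoly S)) p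

/-- The quantity `c = S_xy / √(S_xx S_yy)` of a planar model, at the point `p`. -/
noncomputable def correlation (S : Finset (Fin 2 → ℤ)) (p : Fin 2 → ℝ) : ℝ :=
  secondDeriv S 0 1 p / √(secondDeriv S 0 0 p * secondDeriv S 1 1 p)

/-- `α` is the excursion exponent of the planar model `S`: the step polynomial has a unique
positive critical point `p`, one has `S_xx > 0` and `S_yy > 0` at `p`, and
`α = -1 - π / arccos (-c)`, where `c` is computed at `p`. -/
def HasExcursionExponent (S : Finset (Fin 2 → ℤ)) (α : ℝ) : Prop :=
  ∃ p : Fin 2 → ℝ, IsPositiveCriticalPoint S p ∧ (∀ q, IsPositiveCriticalPoint S q → q = p) ∧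
    0 < secondDeriv S 0 0 p ∧ 0 < secondDeriv S 1 1 p ∧
    α = -1 - Real.pi / Real.arccos (-correlation S p)

/-- The sixteen models; the model numbered `k` (from 1 to 16) has index `k - 1`. -/
def sixteenModels : Fin 16 → Finset (Fin 2 → ℤ) :=
  ![{![-2, 1], ![0, 1], ![1, -2]},
    {![-2, 1], ![1, -2], ![1, 1]},
    {![-2, 1], ![1, -1], ![1, 0]},
    {![-2, 1], ![1, -1], ![1, 1]},
    {![-2, -1], ![1, -1], ![1, 1]},
    {![-2, -1], ![1, 0], ![1, 1]},
    {![-2, 1], ![-1, 1], ![0, 1], ![1, -1]},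
    {![-2, -1], ![-1, -1], ![0, -1], ![1, 1]},
    {![-2, -2], ![-2, 0], ![1, 0], ![1, 1]},
    {![-2, -2], ![-2, 0], ![-1, -1], ![-1, 0], ![1, 0], ![1, 1]},
    {![-2, -1], ![-1, -1], ![0, -1], ![0, 1], ![1, -1], ![1, 1]},
    {![-2, 1], ![-1, 1], ![0, -1], ![0, 1], ![1, -1], ![1, 1]},
    {![-2, 1], ![-1, 0], ![0, -1], ![0, 1], ![1, -2], ![1, 0]},
    {![-2, 1], ![-1, 0], ![0, 1], ![1, -2], ![1, -1], ![1, 1]},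
    {![-2, -1], ![-1, 1], ![0, 1], ![1, -2], ![1, 0], ![1, 1]},
    {![-2, 1], ![-1, 0], ![-1, 1], ![0, -1], ![0, 1], ![1, -2], ![1, -1], ![1, 0], ![1, 1]}]

/-- The excursion exponents of the sixteen models, in the same order. -/
def sixteenExponents : Fin 16 → ℚ :=
  ![-5, -4, -7, -5, -7 / 3, -11 / 5, -7, -11 / 5, -7 / 3, -7 / 3, -5 / 2, -4, -4, -4, -3, -4]

end LatticeWalk

namespace LatticeWalk

/-! Exponents. In the variables log x, log y the step polynomial is a sum of exponentials, strictly
convex once two steps are independent, so a critical point is unique as soon as one is exhibited.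
There the second derivatives are the second moments of the steps weighted by their monomials, up to
powers of x and y that cancel in c. It remains to recognise -c as cos(rπ) with r rational
(`hasExcursionExponent_of_angle`).

Infinite orbits. S keeps a constant value s on an orbit. A valuation on the algebraically closed
field L is chosen so that the generic point sits where the dynamics of the orbit can be read off;
roots of reduced equations lift by `exists_root_of_residue`. Two mechanisms are used.

Tropical (all models but 9 to 12): x and y have sizes that are monomials in ε and h, with 1 < h and
ε h^100 < 1. Whenever prescribed sizes make one monomial of S dominant and of the size of s, some
neighbour in the orbit has these sizes. A cycle of such moves restores the exponents of ε but
divides those of h by m > 1. Repeating it with m-th roots of h gives points whose first coordinates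
have strictly decreasing sizes (`infinite_orbitOf_of_contracting_cycle`).

Critical (models 9 to 12): near a complex critical point, exchanging two roots y, or two roots x, of
S = s is to first order a linear involution of the tangent plane. Their composition has eigenvalues
l and 1/l, with l + 1/l + 2 = τ = p p' / (q q'). If τ is not real then |l| ≠ 1. For a valuation
centred at the point along an eigenvector, the orbit contains points with leading coefficients l^n,
all distinct (`infinite_orbitOf_of_critical`). -/

/-! ### Derivatives of the step polynomial as moments of the steps. -/

/-- Free weights and shifts make this class of functions stable under differentiation, so a second
application yields the second derivatives. -/
theorem partialDeriv_zero_sum (S : Finset (Fin 2 → ℤ)) (c : (Fin 2 → ℤ) → ℝ) (a b : ℤ)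
    {p : Fin 2 → ℝ} (hp : p 0 ≠ 0) :
    partialDeriv 0 (fun q => ∑ s ∈ S, c s * (q 0 ^ (s 0 + a) * q 1 ^ (s 1 + b))) p =
      ∑ s ∈ S, c s * (s 0 + a : ℤ) * (p 0 ^ (s 0 + a - 1) * p 1 ^ (s 1 + b)) := by
  unfold partialDeriv
  apply HasDerivAt.deriv
  simp only [Function.update_self, ne_eq, one_ne_zero, not_false_eq_true, Function.update_of_ne]
  apply HasDerivAt.fun_sum
  intro s _
  exact (((hasDerivAt_zpow (s 0 + a) (p 0) (Or.inl hp)).mul_const (p 1 ^ (s 1 + b))).const_mul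
    (c s)).congr_deriv (by ring)

theorem partialDeriv_one_sum (S : Finset (Fin 2 → ℤ)) (c : (Fin 2 → ℤ) → ℝ) (a b : ℤ)
    {p : Fin 2 → ℝ} (hp : p 1 ≠ 0) :
    partialDeriv 1 (fun q => ∑ s ∈ S, c s * (q 0 ^ (s 0 + a) * q 1 ^ (s 1 + b))) p =
      ∑ s ∈ S, c s * (s 1 + b : ℤ) * (p 0 ^ (s 0 + a) * p 1 ^ (s 1 + b - 1)) := by
  unfold partialDeriv
  apply HasDerivAt.deriv
  simp only [Function.update_self, ne_eq, zero_ne_one, not_false_eq_true, Function.update_of_ne]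
  apply HasDerivAt.fun_sum
  intro s _
  exact (((hasDerivAt_zpow (s 1 + b) (p 1) (Or.inl hp)).const_mul (p 0 ^ (s 0 + a))).const_mul
    (c s)).congr_deriv (by ring)

/-- The formulas for first derivatives hold only off the axes; this is an open condition, so they
can still be differentiated. -/
theorem partialDeriv_congr {i : Fin 2} {f g : (Fin 2 → ℝ) → ℝ} {p : Fin 2 → ℝ}
    (hp : ∀ j, p j ≠ 0) (h : ∀ q : Fin 2 → ℝ, (∀ j, q j ≠ 0) → f q = g q) :
    partialDeriv i f p = partialDeriv i g p := by
  unfold partialDeriv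
  apply Filter.EventuallyEq.deriv_eq
  filter_upwards [isOpen_ne.mem_nhds (hp i)] with t ht
  apply h
  intro j
  by_cases hj : j = i
  · subst hj; simpa using ht
  · simpa [hj] using hp j

theorem stepPoly_eq_weighted (S : Finset (Fin 2 → ℤ)) : (stepPoly S : (Fin 2 → ℝ) → ℝ) =
    fun q => ∑ s ∈ S, (1 : ℝ) * (q 0 ^ (s 0 + 0) * q 1 ^ (s 1 + 0)) := by
  funext q
  simp [stepPoly, Fin.prod_univ_two]

/-- The `(m, n)`-moment of the steps of `S`, with weights the values at `p` of their monomials. -/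
noncomputable def moment (S : Finset (Fin 2 → ℤ)) (m n : ℕ) (p : Fin 2 → ℝ) : ℝ :=
  ∑ s ∈ S, (s 0 : ℝ) ^ m * (s 1 : ℝ) ^ n * (p 0 ^ s 0 * p 1 ^ s 1)

section Derivatives

variable {S : Finset (Fin 2 → ℤ)} {p : Fin 2 → ℝ}

theorem partialDeriv_zero_stepPoly (hp : ∀ j, p j ≠ 0) :
    partialDeriv 0 (stepPoly S) p = moment S 1 0 p / p 0 := by
  rw [stepPoly_eq_weighted, partialDeriv_zero_sum S _ 0 0 (hp 0), moment, Finset.sum_div]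
  refine Finset.sum_congr rfl fun s _ => ?_
  rw [zpow_sub₀ (hp 0)]
  simp
  ring

theorem partialDeriv_one_stepPoly (hp : ∀ j, p j ≠ 0) :
    partialDeriv 1 (stepPoly S) p = moment S 0 1 p / p 1 := by
  rw [stepPoly_eq_weighted, partialDeriv_one_sum S _ 0 0 (hp 1), moment, Finset.sum_div]
  refine Finset.sum_congr rfl fun s _ => ?_
  rw [zpow_sub₀ (hp 1)]
  simp
  ring

theorem secondDeriv_zero_zero (hp : ∀ j, p j ≠ 0) :
    secondDeriv S 0 0 p = (moment S 2 0 p - moment S 1 0 p) / p 0 ^ 2 := by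
  have h : ∀ q : Fin 2 → ℝ, (∀ j, q j ≠ 0) → partialDeriv 0 (stepPoly S) q =
      ∑ s ∈ S, (s 0 : ℝ) * (q 0 ^ (s 0 + -1) * q 1 ^ (s 1 + 0)) := by
    intro q hq
    rw [stepPoly_eq_weighted, partialDeriv_zero_sum S _ 0 0 (hq 0)]
    simp [sub_eq_add_neg]
  rw [secondDeriv, partialDeriv_congr hp h, partialDeriv_zero_sum S _ _ _ (hp 0), moment, moment,
    ← Finset.sum_sub_distrib, Finset.sum_div]
  refine Finset.sum_congr rfl fun s _ => ?_
  rw [zpow_sub₀ (hp 0), zpow_add₀ (hp 0)]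
  push_cast
  have := hp 0
  simp
  field_simp
  try ring

theorem secondDeriv_zero_one (hp : ∀ j, p j ≠ 0) :
    secondDeriv S 0 1 p = moment S 1 1 p / (p 0 * p 1) := by
  have h : ∀ q : Fin 2 → ℝ, (∀ j, q j ≠ 0) → partialDeriv 1 (stepPoly S) q =
      ∑ s ∈ S, (s 1 : ℝ) * (q 0 ^ (s 0 + 0) * q 1 ^ (s 1 + -1)) := by
    intro q hq
    rw [stepPoly_eq_weighted, partialDeriv_one_sum S _ 0 0 (hq 1)]
    simp [sub_eq_add_neg]
  rw [secondDeriv, partialDeriv_congr hp h, partialDeriv_zero_sum S _ _ _ (hp 0), moment,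
    Finset.sum_div]
  refine Finset.sum_congr rfl fun s _ => ?_
  rw [zpow_sub₀ (hp 0), zpow_add₀ (hp 1)]
  have := hp 0
  have := hp 1
  simp
  field_simp
  try ring

theorem secondDeriv_one_one (hp : ∀ j, p j ≠ 0) :
    secondDeriv S 1 1 p = (moment S 0 2 p - moment S 0 1 p) / p 1 ^ 2 := by
  have h : ∀ q : Fin 2 → ℝ, (∀ j, q j ≠ 0) → partialDeriv 1 (stepPoly S) q =
      ∑ s ∈ S, (s 1 : ℝ) * (q 0 ^ (s 0 + 0) * q 1 ^ (s 1 + -1)) := by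
    intro q hq
    rw [stepPoly_eq_weighted, partialDeriv_one_sum S _ 0 0 (hq 1)]
    simp [sub_eq_add_neg]
  rw [secondDeriv, partialDeriv_congr hp h, partialDeriv_one_sum S _ _ _ (hp 1), moment, moment,
    ← Finset.sum_sub_distrib, Finset.sum_div]
  refine Finset.sum_congr rfl fun s _ => ?_
  rw [zpow_sub₀ (hp 1), zpow_add₀ (hp 1)]
  push_cast
  have := hp 1
  simp
  field_simp
  try ring

theorem isPositiveCriticalPoint_iff : IsPositiveCriticalPoint S p ↔
    (0 < p 0 ∧ 0 < p 1) ∧ moment S 1 0 p = 0 ∧ moment S 0 1 p = 0 := by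
  unfold IsPositiveCriticalPoint
  rw [Fin.forall_fin_two]
  refine and_congr_right fun ⟨h0, h1⟩ => ?_
  have hp : ∀ j, p j ≠ 0 := Fin.forall_fin_two.2 ⟨h0.ne', h1.ne'⟩
  rw [Fin.forall_fin_two, partialDeriv_zero_stepPoly hp, partialDeriv_one_stepPoly hp]
  simp [h0.ne', h1.ne']

end Derivatives

/-! ### Uniqueness of the critical point, and the exponent from an angle. -/

/-- A step polynomial has at most one positive critical point when two of its steps are linearly
independent: it is a strictly convex function of the logarithms of the variables. -/
theorem IsPositiveCriticalPoint.unique {S : Finset (Fin 2 → ℤ)} {p q : Fin 2 → ℝ}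
    {s t : Fin 2 → ℤ} (hs : s ∈ S) (ht : t ∈ S) (hst : s 0 * t 1 - s 1 * t 0 ≠ 0)
    (hp : IsPositiveCriticalPoint S p) (hq : IsPositiveCriticalPoint S q) : q = p := by
  rw [isPositiveCriticalPoint_iff] at hp hq
  obtain ⟨⟨hp0, hp1⟩, hpx, hpy⟩ := hp
  obtain ⟨⟨hq0, hq1⟩, hqx, hqy⟩ := hq
  set a := Real.log (q 0 / p 0) with ha
  set b := Real.log (q 1 / p 1) with hb
  have hea : Real.exp a = q 0 / p 0 := Real.exp_log (by positivity)
  have heb : Real.exp b = q 1 / p 1 := Real.exp_log (by positivity)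
  let z : (Fin 2 → ℤ) → ℝ := fun r => r 0 * a + r 1 * b
  let m : (Fin 2 → ℤ) → ℝ := fun r => p 0 ^ r 0 * p 1 ^ r 1
  have hexp : ∀ r, m r * Real.exp (z r) = q 0 ^ r 0 * q 1 ^ r 1 := by
    intro r
    simp only [m, z]
    rw [Real.exp_add, mul_comm (r 0 : ℝ), mul_comm (r 1 : ℝ), Real.exp_mul, Real.exp_mul,
      Real.rpow_intCast, Real.rpow_intCast, hea, heb, div_zpow, div_zpow]
    field_simp
  -- Monotonicity of the gradient in logarithmic coordinates: this sum pairs the difference of the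
  -- gradients at `q` and `p`, both zero, with log q - log p. Its terms are nonnegative, so each one
  -- vanishes.
  have hsum : ∑ r ∈ S, m r * ((Real.exp (z r) - 1) * z r) = 0 := by
    have : ∑ r ∈ S, m r * ((Real.exp (z r) - 1) * z r) =
        a * moment S 1 0 q + b * moment S 0 1 q - (a * moment S 1 0 p + b * moment S 0 1 p) := by
      simp only [moment, Finset.mul_sum, ← Finset.sum_add_distrib, ← Finset.sum_sub_distrib]
      refine Finset.sum_congr rfl fun r _ => ?_
      rw [← hexp]
      simp only [m, z]
      ring
    rw [this, hpx, hpy, hqx, hqy]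
    ring
  have hnn : ∀ w : ℝ, 0 ≤ (Real.exp w - 1) * w := by
    intro w
    rcases le_total 0 w with h | h
    · exact mul_nonneg (by linarith [Real.one_le_exp h]) h
    · exact mul_nonneg_of_nonpos_of_nonpos (by linarith [Real.exp_le_one_iff.2 h]) h
  have hm : ∀ r, 0 < m r := fun r => by positivity
  have hz : ∀ r ∈ S, z r = 0 := by
    intro r hr
    have := (Finset.sum_eq_zero_iff_of_nonneg
      (fun r _ => mul_nonneg (hm r).le (hnn (z r)))).1 hsum r hr
    rcases mul_eq_zero.1 ((mul_eq_zero.1 this).resolve_left (hm r).ne') with h | h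
    · exact (Real.exp_eq_one_iff _).1 (by linarith)
    · exact h
  have h1 : (s 0 : ℝ) * a + s 1 * b = 0 := hz s hs
  have h2 : (t 0 : ℝ) * a + t 1 * b = 0 := hz t ht
  have hd : ((s 0 : ℝ) * t 1 - s 1 * t 0) ≠ 0 := by exact_mod_cast hst
  have ha0 : a = 0 := by
    apply (mul_eq_zero.1 (_ : ((s 0 : ℝ) * t 1 - s 1 * t 0) * a = 0)).resolve_left hd
    linear_combination t 1 * h1 - s 1 * h2
  have hb0 : b = 0 := by
    apply (mul_eq_zero.1 (_ : ((s 0 : ℝ) * t 1 - s 1 * t 0) * b = 0)).resolve_left hd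
    linear_combination s 0 * h2 - t 0 * h1
  rw [ha0, Real.exp_zero, eq_div_iff hp0.ne', one_mul] at hea
  rw [hb0, Real.exp_zero, eq_div_iff hp1.ne', one_mul] at heb
  funext i
  fin_cases i
  · exact hea.symm
  · exact heb.symm

/-- The excursion exponent from the angle `θ = arccos (-c)`. -/
theorem hasExcursionExponent_of_angle {S : Finset (Fin 2 → ℤ)} {p : Fin 2 → ℝ}
    {s t : Fin 2 → ℤ} (hs : s ∈ S) (ht : t ∈ S) (hst : s 0 * t 1 - s 1 * t 0 ≠ 0)
    (hp0 : 0 < p 0) (hp1 : 0 < p 1) (hx : moment S 1 0 p = 0) (hy : moment S 0 1 p = 0)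
    (hxx : 0 < moment S 2 0 p) (hyy : 0 < moment S 0 2 p) {r : ℝ} (hr0 : 0 ≤ r) (hr1 : r ≤ 1)
    (hsign : moment S 1 1 p * Real.cos (r * Real.pi) ≤ 0)
    (hsq : moment S 1 1 p ^ 2 =
      Real.cos (r * Real.pi) ^ 2 * (moment S 2 0 p * moment S 0 2 p)) :
    HasExcursionExponent S (-1 - 1 / r) := by
  have hp : ∀ j, p j ≠ 0 := Fin.forall_fin_two.2 ⟨hp0.ne', hp1.ne'⟩
  have hcrit : IsPositiveCriticalPoint S p := isPositiveCriticalPoint_iff.2 ⟨⟨hp0, hp1⟩, hx, hy⟩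
  have hc : -correlation S p = Real.cos (r * Real.pi) := by
    have hD := mul_pos hxx hyy
    have e1 : secondDeriv S 0 0 p * secondDeriv S 1 1 p =
        moment S 2 0 p * moment S 0 2 p / (p 0 * p 1) ^ 2 := by
      rw [secondDeriv_zero_zero hp, secondDeriv_one_one hp, hx, hy]
      field_simp
      ring
    rw [correlation, e1, secondDeriv_zero_one hp, Real.sqrt_div hD.le,
      Real.sqrt_sq (by positivity), div_div_div_cancel_right₀ (by positivity)]
    have hsp := Real.sqrt_pos.2 hD
    rw [← neg_div, div_eq_iff hsp.ne']
    have h2 : moment S 1 1 p ^ 2 =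
        (Real.cos (r * Real.pi) * √(moment S 2 0 p * moment S 0 2 p)) ^ 2 := by
      rw [mul_pow, Real.sq_sqrt hD.le, hsq]
    -- The squares fix the correlation up to sign only. With the wrong sign, `hsign` forces the
    -- cosine to vanish, and then both signs agree.
    rcases sq_eq_sq_iff_eq_or_eq_neg.1 h2 with h | h
    · have : moment S 1 1 p * Real.cos (r * Real.pi) =
          Real.cos (r * Real.pi) ^ 2 * √(moment S 2 0 p * moment S 0 2 p) := by rw [h]; ring
      have h0 : Real.cos (r * Real.pi) ^ 2 = 0 := by
        by_contra hne
        have : 0 < Real.cos (r * Real.pi) ^ 2 := lt_of_le_of_ne (sq_nonneg _) (Ne.symm hne)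
        nlinarith [mul_pos this hsp]
      rw [h, pow_eq_zero_iff (two_ne_zero) |>.1 h0]
      simp
    · rw [h]; ring
  refine ⟨p, hcrit, fun q hq => hcrit.unique hs ht hst hq, ?_, ?_, ?_⟩
  · rw [secondDeriv_zero_zero hp, hx, sub_zero]; positivity
  · rw [secondDeriv_one_one hp, hy, sub_zero]; positivity
  · rw [hc, Real.arccos_cos (by positivity) (by nlinarith [Real.pi_pos])]
    -- At r = 0 both quotients are divisions by zero, hence both are 0.
    rcases eq_or_ne r 0 with rfl | h
    · simp
    · have := Real.pi_ne_zero
      field_simp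

theorem hasExcursionExponent_of_moments {S : Finset (Fin 2 → ℤ)} {p : Fin 2 → ℝ}
    (s t : Fin 2 → ℤ) (A B D κ r : ℝ) {α : ℝ} (hs : s ∈ S) (ht : t ∈ S)
    (hst : s 0 * t 1 - s 1 * t 0 ≠ 0) (hp0 : 0 < p 0) (hp1 : 0 < p 1)
    (hx : moment S 1 0 p = 0) (hy : moment S 0 1 p = 0) (hA : moment S 2 0 p = A)
    (hB : moment S 1 1 p = B) (hD : moment S 0 2 p = D) (hA0 : 0 < A) (hD0 : 0 < D)
    (hr0 : 0 ≤ r) (hr1 : r ≤ 1) (hα : α = -1 - 1 / r) (hκ : Real.cos (r * Real.pi) = κ)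
    (hsign : B * κ ≤ 0) (hsq : B ^ 2 = κ ^ 2 * (A * D)) : HasExcursionExponent S α := by
  subst hA hB hD hκ hα
  exact hasExcursionExponent_of_angle hs ht hst hp0 hp1 hx hy hA0 hD0 hr0 hr1 hsign hsq

/-! ### Critical points and exponents of the sixteen models. -/

theorem cos_one_div_two_mul_pi : Real.cos (1 / 2 * Real.pi) = 0 := by
  rw [← Real.cos_pi_div_two]; ring_nf

theorem cos_one_div_three_mul_pi : Real.cos (1 / 3 * Real.pi) = 1 / 2 := by
  rw [← Real.cos_pi_div_three]; ring_nf

theorem cos_two_div_three_mul_pi : Real.cos (2 / 3 * Real.pi) = -(1 / 2) := by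
  rw [← Real.cos_pi_div_three, ← Real.cos_pi_sub]; ring_nf

theorem cos_one_div_four_mul_pi : Real.cos (1 / 4 * Real.pi) = √2 / 2 := by
  rw [← Real.cos_pi_div_four]; ring_nf

theorem cos_three_div_four_mul_pi : Real.cos (3 / 4 * Real.pi) = -(√2 / 2) := by
  rw [← Real.cos_pi_div_four, ← Real.cos_pi_sub]; ring_nf

theorem cos_one_div_six_mul_pi : Real.cos (1 / 6 * Real.pi) = √3 / 2 := by
  rw [← Real.cos_pi_div_six]; ring_nf

theorem cos_five_div_six_mul_pi : Real.cos (5 / 6 * Real.pi) = -(√3 / 2) := by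
  rw [← Real.cos_pi_div_six, ← Real.cos_pi_sub]; ring_nf

theorem exists_pos_cube_eq {a : ℝ} (ha : 0 < a) : ∃ x : ℝ, 0 < x ∧ x ^ 3 = a :=
  ⟨a ^ ((3 : ℕ) : ℝ)⁻¹, by positivity, Real.rpow_inv_natCast_pow ha.le (by norm_num)⟩

theorem exists_pos_sq_eq {a : ℝ} (ha : 0 < a) : ∃ x : ℝ, 0 < x ∧ x ^ 2 = a :=
  ⟨√a, by positivity, Real.sq_sqrt ha.le⟩

theorem hasExcursionExponent_model_one : HasExcursionExponent
    {![-2, 1], ![0, 1], ![1, -2]} (-5) := by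
  -- The first critical equation reads x y⁻³ = 2 x⁻²; the second then becomes 1 = 3 x⁻². Once
  -- inverses are eliminated, all moments are multiples of y, which disappears from the correlation.
  -- The other models follow this pattern.
  obtain ⟨x, hx0, hx⟩ := exists_pos_sq_eq (show (0 : ℝ) < 3 by norm_num)
  obtain ⟨y, hy0, hy⟩ := exists_pos_cube_eq (show (0 : ℝ) < x ^ 3 / 2 by positivity)
  have hxi : (x ^ 2)⁻¹ = 1 / 3 := by rw [hx]; norm_num
  have hyi : x * (y ^ 2)⁻¹ = 2 * y / 3 := by field_simp; linear_combination -2 * hy - x * hx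
  refine hasExcursionExponent_of_moments (p := ![x, y]) ![0, 1] ![1, -2] (2 * y) ((-2) * y) (4 * y) (√2 / 2) (1 / 4)
    (by simp) (by simp) (by simp) (by simpa) (by simpa) ?_ ?_ ?_ ?_ ?_ (by positivity)
    (by positivity) (by norm_num) (by norm_num) (by norm_num) cos_one_div_four_mul_pi ?_ ?_
  · norm_num [moment, hxi, hyi]
    ring
  · norm_num [moment, hxi, hyi]
    ring
  · norm_num [moment, hxi, hyi]
    ring
  · norm_num [moment, hxi, hyi]
    ring
  · norm_num [moment, hxi, hyi]
    ring
  · have : 0 < y := by positivity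
    nlinarith [Real.sqrt_nonneg 2, Real.sqrt_nonneg 3]
  · have h : √2 ^ 2 = (2 : ℝ) := Real.sq_sqrt (by norm_num)
    ring_nf
    rw [h]
    ring

theorem hasExcursionExponent_model_two : HasExcursionExponent
    {![-2, 1], ![1, -2], ![1, 1]} (-4) := by
  refine hasExcursionExponent_of_moments (p := ![1, 1]) ![1, -2] ![1, 1] (6) (-3) (6) (1 / 2) (1 / 3) (by simp) (by simp)
    (by simp) (by simp) (by simp) ?_ ?_ ?_ ?_ ?_ (by norm_num) (by norm_num) (by norm_num)
    (by norm_num) (by norm_num) cos_one_div_three_mul_pi (by norm_num) ?_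
  · norm_num [moment]
  · norm_num [moment]
  · norm_num [moment]
  · norm_num [moment]
  · norm_num [moment]
  · norm_num

theorem hasExcursionExponent_model_three : HasExcursionExponent
    {![-2, 1], ![1, -1], ![1, 0]} (-7) := by
  refine hasExcursionExponent_of_moments (p := ![1, 1]) ![1, -1] ![1, 0] (6) (-3) (2) (√3 / 2) (1 / 6) (by simp) (by simp)
    (by simp) (by simp) (by simp) ?_ ?_ ?_ ?_ ?_ (by norm_num) (by norm_num) (by norm_num)
    (by norm_num) (by norm_num) cos_one_div_six_mul_pi (by linarith [Real.sqrt_nonneg 3]) ?_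
  · norm_num [moment]
  · norm_num [moment]
  · norm_num [moment]
  · norm_num [moment]
  · norm_num [moment]
  · have h : √3 ^ 2 = (3 : ℝ) := Real.sq_sqrt (by norm_num)
    ring_nf
    rw [h]
    ring

theorem hasExcursionExponent_model_four : HasExcursionExponent
    {![-2, 1], ![1, -1], ![1, 1]} (-5) := by
  obtain ⟨x, hx0, hx⟩ := exists_pos_cube_eq (show (0 : ℝ) < 1 / 2 by norm_num)
  have hxi : (x ^ 2)⁻¹ = 2 * x := by field_simp; linarith
  obtain ⟨y, hy0, hy⟩ := exists_pos_sq_eq (show (0 : ℝ) < 1 / 3 by norm_num)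
  have hyi : y⁻¹ = 3 * y := by field_simp; linarith
  refine hasExcursionExponent_of_moments (p := ![x, y]) ![1, -1] ![1, 1] (12 * (x * y)) ((-6) * (x * y)) (6 * (x * y)) (√2 / 2) (1 / 4)
    (by simp) (by simp) (by simp) (by simpa) (by simpa) ?_ ?_ ?_ ?_ ?_ (by positivity)
    (by positivity) (by norm_num) (by norm_num) (by norm_num) cos_one_div_four_mul_pi ?_ ?_
  · norm_num [moment, hxi, hyi]
    ring
  · norm_num [moment, hxi, hyi]
    ring
  · norm_num [moment, hxi, hyi]
    ring
  · norm_num [moment, hxi, hyi]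
    ring
  · norm_num [moment, hxi, hyi]
    ring
  · have : 0 < (x * y) := by positivity
    nlinarith [Real.sqrt_nonneg 2, Real.sqrt_nonneg 3]
  · have h : √2 ^ 2 = (2 : ℝ) := Real.sq_sqrt (by norm_num)
    ring_nf
    rw [h]
    ring

theorem hasExcursionExponent_model_five : HasExcursionExponent
    {![-2, -1], ![1, -1], ![1, 1]} (-7 / 3) := by
  obtain ⟨x, hx0, hx⟩ := exists_pos_cube_eq (show (0 : ℝ) < 1 / 2 by norm_num)
  have hxi : (x ^ 2)⁻¹ = 2 * x := by field_simp; linarith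
  obtain ⟨y, hy0, hy⟩ := exists_pos_sq_eq (show (0 : ℝ) < 3 by norm_num)
  have hyi : y⁻¹ = y / 3 := by field_simp; linarith
  refine hasExcursionExponent_of_moments (p := ![x, y]) ![1, -1] ![1, 1] (4 * (x * y)) (2 * (x * y)) (2 * (x * y)) (-(√2 / 2)) (3 / 4)
    (by simp) (by simp) (by simp) (by simpa) (by simpa) ?_ ?_ ?_ ?_ ?_ (by positivity)
    (by positivity) (by norm_num) (by norm_num) (by norm_num) cos_three_div_four_mul_pi ?_ ?_
  · norm_num [moment, hxi, hyi]
    ring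
  · norm_num [moment, hxi, hyi]
    ring
  · norm_num [moment, hxi, hyi]
    ring
  · norm_num [moment, hxi, hyi]
    ring
  · norm_num [moment, hxi, hyi]
    ring
  · have : 0 < (x * y) := by positivity
    nlinarith [Real.sqrt_nonneg 2, Real.sqrt_nonneg 3]
  · have h : √2 ^ 2 = (2 : ℝ) := Real.sq_sqrt (by norm_num)
    ring_nf
    rw [h]
    ring

theorem hasExcursionExponent_model_six : HasExcursionExponent
    {![-2, -1], ![1, 0], ![1, 1]} (-11 / 5) := by
  refine hasExcursionExponent_of_moments (p := ![1, 1]) ![1, 0] ![1, 1] (6) (3) (2) (-(√3 / 2)) (5 / 6) (by simp) (by simp)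
    (by simp) (by simp) (by simp) ?_ ?_ ?_ ?_ ?_ (by norm_num) (by norm_num) (by norm_num)
    (by norm_num) (by norm_num) cos_five_div_six_mul_pi (by linarith [Real.sqrt_nonneg 3]) ?_
  · norm_num [moment]
  · norm_num [moment]
  · norm_num [moment]
  · norm_num [moment]
  · norm_num [moment]
  · have h : √3 ^ 2 = (3 : ℝ) := Real.sq_sqrt (by norm_num)
    ring_nf
    rw [h]
    ring

theorem hasExcursionExponent_model_seven : HasExcursionExponent
    {![-2, 1], ![-1, 1], ![0, 1], ![1, -1]} (-7) := by
  obtain ⟨y, hy0, hy⟩ := exists_pos_sq_eq (show (0 : ℝ) < 1 / 3 by norm_num)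
  have hyi : y⁻¹ = 3 * y := by field_simp; linarith
  refine hasExcursionExponent_of_moments (p := ![1, y]) ![0, 1] ![1, -1] (8 * y) ((-6) * y) (6 * y) (√3 / 2) (1 / 6)
    (by simp) (by simp) (by simp) (by simp) (by simpa) ?_ ?_ ?_ ?_ ?_ (by positivity)
    (by positivity) (by norm_num) (by norm_num) (by norm_num) cos_one_div_six_mul_pi ?_ ?_
  · norm_num [moment, hyi]
    ring
  · norm_num [moment, hyi]
    ring
  · norm_num [moment, hyi]
    ring
  · norm_num [moment, hyi]
    ring
  · norm_num [moment, hyi]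
    ring
  · have : 0 < y := by positivity
    nlinarith [Real.sqrt_nonneg 2, Real.sqrt_nonneg 3]
  · have h : √3 ^ 2 = (3 : ℝ) := Real.sq_sqrt (by norm_num)
    ring_nf
    rw [h]
    ring

theorem hasExcursionExponent_model_eight : HasExcursionExponent
    {![-2, -1], ![-1, -1], ![0, -1], ![1, 1]} (-11 / 5) := by
  obtain ⟨y, hy0, hy⟩ := exists_pos_sq_eq (show (0 : ℝ) < 3 by norm_num)
  have hyi : y⁻¹ = y / 3 := by field_simp; linarith
  refine hasExcursionExponent_of_moments (p := ![1, y]) ![0, -1] ![1, 1] (8 / 3 * y) (2 * y) (2 * y) (-(√3 / 2)) (5 / 6)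
    (by simp) (by simp) (by simp) (by simp) (by simpa) ?_ ?_ ?_ ?_ ?_ (by positivity)
    (by positivity) (by norm_num) (by norm_num) (by norm_num) cos_five_div_six_mul_pi ?_ ?_
  · norm_num [moment, hyi]
    ring
  · norm_num [moment, hyi]
    ring
  · norm_num [moment, hyi]
    ring
  · norm_num [moment, hyi]
    ring
  · norm_num [moment, hyi]
    ring
  · have : 0 < y := by positivity
    nlinarith [Real.sqrt_nonneg 2, Real.sqrt_nonneg 3]
  · have h : √3 ^ 2 = (3 : ℝ) := Real.sq_sqrt (by norm_num)
    ring_nf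
    rw [h]
    ring

theorem hasExcursionExponent_model_nine : HasExcursionExponent
    {![-2, -2], ![-2, 0], ![1, 0], ![1, 1]} (-7 / 3) := by
  obtain ⟨x, hx0, hx⟩ := exists_pos_cube_eq (show (0 : ℝ) < 2 by norm_num)
  have hxi : (x ^ 2)⁻¹ = x / 2 := by field_simp; linarith
  refine hasExcursionExponent_of_moments (p := ![x, 1]) ![1, 0] ![1, 1] (6 * x) (3 * x) (3 * x) (-(√2 / 2)) (3 / 4)
    (by simp) (by simp) (by simp) (by simpa) (by simp) ?_ ?_ ?_ ?_ ?_ (by positivity)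
    (by positivity) (by norm_num) (by norm_num) (by norm_num) cos_three_div_four_mul_pi ?_ ?_
  · norm_num [moment, hxi]
    ring
  · norm_num [moment, hxi]
    ring
  · norm_num [moment, hxi]
    ring
  · norm_num [moment, hxi]
    ring
  · norm_num [moment, hxi]
    ring
  · have : 0 < x := by positivity
    nlinarith [Real.sqrt_nonneg 2, Real.sqrt_nonneg 3]
  · have h : √2 ^ 2 = (2 : ℝ) := Real.sq_sqrt (by norm_num)
    ring_nf
    rw [h]
    ring

theorem hasExcursionExponent_model_ten : HasExcursionExponent
    {![-2, -2], ![-2, 0], ![-1, -1], ![-1, 0], ![1, 0], ![1, 1]} (-7 / 3) := by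
  -- Here w = 1/x: at y = 1 the equation in x reads x = 2 x⁻² + x⁻¹.
  obtain ⟨w, hw, hw1⟩ : ∃ w ∈ Set.Icc (0 : ℝ) 1, 2 * w ^ 3 + w ^ 2 = 1 :=
    intermediate_value_Icc (by norm_num) (f := fun w : ℝ => 2 * w ^ 3 + w ^ 2) (by fun_prop)
      (by norm_num)
  have hw0 : 0 < w := lt_of_le_of_ne hw.1 (by rintro rfl; norm_num at hw1)
  obtain ⟨x, hx⟩ : ∃ x, x = 2 * w ^ 2 + w := ⟨_, rfl⟩
  have hx0 : 0 < x := by rw [hx]; positivity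
  have hxi : x⁻¹ = w := by rw [inv_eq_iff_eq_inv, hx]; field_simp; linarith
  have hxi2 : (x ^ 2)⁻¹ = w ^ 2 := by rw [← inv_pow, hxi]
  refine hasExcursionExponent_of_moments (p := ![x, 1]) ![1, 0] ![1, 1] (4 * (3 * w ^ 2 + w)) (2 * (3 * w ^ 2 + w)) (2 * (3 * w ^ 2 + w)) (-(√2 / 2)) (3 / 4)
    (by simp) (by simp) (by simp) (by simpa) (by simp) ?_ ?_ ?_ ?_ ?_ (by positivity)
    (by positivity) (by norm_num) (by norm_num) (by norm_num) cos_three_div_four_mul_pi ?_ ?_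
  · norm_num [moment, hxi, hxi2]
    rw [hx]
    ring
  · norm_num [moment, hxi, hxi2]
    rw [hx]
    ring
  · norm_num [moment, hxi, hxi2]
    rw [hx]
    ring
  · norm_num [moment, hxi, hxi2]
    rw [hx]
    ring
  · norm_num [moment, hxi, hxi2]
    rw [hx]
    ring
  · have : 0 < (3 * w ^ 2 + w) := by positivity
    nlinarith [Real.sqrt_nonneg 2, Real.sqrt_nonneg 3]
  · have h : √2 ^ 2 = (2 : ℝ) := Real.sq_sqrt (by norm_num)
    ring_nf
    rw [h]
    ring

theorem hasExcursionExponent_model_eleven : HasExcursionExponent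
    {![-2, -1], ![-1, -1], ![0, -1], ![0, 1], ![1, -1], ![1, 1]} (-5 / 2) := by
  obtain ⟨y, hy0, hy⟩ := exists_pos_sq_eq (show (0 : ℝ) < 2 by norm_num)
  have hyi : y⁻¹ = y / 2 := by field_simp; linarith
  refine hasExcursionExponent_of_moments (p := ![1, y]) ![1, -1] ![1, 1] (4 * y) (2 * y) (4 * y) (-(1 / 2)) (2 / 3)
    (by simp) (by simp) (by simp) (by simp) (by simpa) ?_ ?_ ?_ ?_ ?_ (by positivity)
    (by positivity) (by norm_num) (by norm_num) (by norm_num) cos_two_div_three_mul_pi ?_ ?_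
  · norm_num [moment, hyi]
    ring
  · norm_num [moment, hyi]
    ring
  · norm_num [moment, hyi]
    ring
  · norm_num [moment, hyi]
    ring
  · norm_num [moment, hyi]
    ring
  · have : 0 < y := by positivity
    nlinarith [Real.sqrt_nonneg 2, Real.sqrt_nonneg 3]
  · ring

theorem hasExcursionExponent_model_twelve : HasExcursionExponent
    {![-2, 1], ![-1, 1], ![0, -1], ![0, 1], ![1, -1], ![1, 1]} (-4) := by
  obtain ⟨y, hy0, hy⟩ := exists_pos_sq_eq (show (0 : ℝ) < 1 / 2 by norm_num)
  have hyi : y⁻¹ = 2 * y := by field_simp; linarith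
  refine hasExcursionExponent_of_moments (p := ![1, y]) ![1, -1] ![1, 1] (8 * y) ((-4) * y) (8 * y) (1 / 2) (1 / 3)
    (by simp) (by simp) (by simp) (by simp) (by simpa) ?_ ?_ ?_ ?_ ?_ (by positivity)
    (by positivity) (by norm_num) (by norm_num) (by norm_num) cos_one_div_three_mul_pi ?_ ?_
  · norm_num [moment, hyi]
  · norm_num [moment, hyi]
    ring
  · norm_num [moment, hyi]
    ring
  · norm_num [moment, hyi]
    ring
  · norm_num [moment, hyi]
    ring
  · have : 0 < y := by positivity
    nlinarith [Real.sqrt_nonneg 2, Real.sqrt_nonneg 3]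
  · ring

theorem hasExcursionExponent_model_thirteen : HasExcursionExponent
    {![-2, 1], ![-1, 0], ![0, -1], ![0, 1], ![1, -2], ![1, 0]} (-4) := by
  -- The step set is symmetric, so the critical point lies on the diagonal.
  obtain ⟨z, hz0, hz⟩ := exists_pos_sq_eq (show (0 : ℝ) < 2 by norm_num)
  have hzi : z⁻¹ = z / 2 := by field_simp; linarith
  refine hasExcursionExponent_of_moments (p := ![z, z]) ![1, -2] ![1, 0] (4 * z) ((-2) * z) (4 * z) (1 / 2) (1 / 3)
    (by simp) (by simp) (by simp) (by simpa) (by simpa) ?_ ?_ ?_ ?_ ?_ (by positivity)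
    (by positivity) (by norm_num) (by norm_num) (by norm_num) cos_one_div_three_mul_pi ?_ ?_
  · norm_num [moment, hz, hzi]
    ring
  · norm_num [moment, hz, hzi]
    ring
  · norm_num [moment, hz, hzi]
    ring
  · norm_num [moment, hz, hzi]
    ring
  · norm_num [moment, hz, hzi]
    ring
  · have : 0 < z := by positivity
    nlinarith [Real.sqrt_nonneg 2, Real.sqrt_nonneg 3]
  · ring

theorem hasExcursionExponent_model_fourteen : HasExcursionExponent
    {![-2, 1], ![-1, 0], ![0, 1], ![1, -2], ![1, -1], ![1, 1]} (-4) := by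
  refine hasExcursionExponent_of_moments (p := ![1, 1]) ![1, -1] ![1, 1] (8) (-4) (8) (1 / 2) (1 / 3) (by simp) (by simp)
    (by simp) (by simp) (by simp) ?_ ?_ ?_ ?_ ?_ (by norm_num) (by norm_num) (by norm_num)
    (by norm_num) (by norm_num) cos_one_div_three_mul_pi (by norm_num) ?_
  · norm_num [moment]
  · norm_num [moment]
  · norm_num [moment]
  · norm_num [moment]
  · norm_num [moment]
  · norm_num

theorem hasExcursionExponent_model_fifteen : HasExcursionExponent
    {![-2, -1], ![-1, 1], ![0, 1], ![1, -2], ![1, 0], ![1, 1]} (-3) := by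
  refine hasExcursionExponent_of_moments (p := ![1, 1]) ![1, 0] ![1, 1] (8) (0) (8) (0) (1 / 2) (by simp) (by simp)
    (by simp) (by simp) (by simp) ?_ ?_ ?_ ?_ ?_ (by norm_num) (by norm_num) (by norm_num)
    (by norm_num) (by norm_num) cos_one_div_two_mul_pi (by norm_num) ?_
  · norm_num [moment]
  · norm_num [moment]
  · norm_num [moment]
  · norm_num [moment]
  · norm_num [moment]
  · norm_num

theorem hasExcursionExponent_model_sixteen : HasExcursionExponent
    {![-2, 1], ![-1, 0], ![-1, 1], ![0, -1], ![0, 1], ![1, -2], ![1, -1], ![1, 0], ![1, 1]} (-4) := by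
  refine hasExcursionExponent_of_moments (p := ![1, 1]) ![1, 0] ![1, 1] (10) (-5) (10) (1 / 2) (1 / 3) (by simp) (by simp)
    (by simp) (by simp) (by simp) ?_ ?_ ?_ ?_ ?_ (by norm_num) (by norm_num) (by norm_num)
    (by norm_num) (by norm_num) cos_one_div_three_mul_pi (by norm_num) ?_
  · norm_num [moment]
  · norm_num [moment]
  · norm_num [moment]
  · norm_num [moment]
  · norm_num [moment]
  · norm_num


/-! ### Valuations centred at a point, and lifting of roots. -/

section Valuations

/-- `L` is algebraic over k(w), and w has as many members as a transcendence basis, so it is one.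
This serves to change coordinates before choosing a valuation. -/
theorem algebraicIndependent_of_isAlgebraic {ι k L : Type*} [Finite ι] [Field k] [Field L]
    [Algebra k L] {u w : ι → L} (hu : IsTranscendenceBasis k u)
    (h : ∀ i, IsAlgebraic (Algebra.adjoin k (Set.range w)) (u i)) : AlgebraicIndependent k w := by
  have : Algebra.IsAlgebraic (Algebra.adjoin k (Set.range w)) L :=
    ⟨fun a => (hu.isAlgebraic.1 a).adjoin_of_forall_isAlgebraic
      (by rintro _ ⟨⟨i, rfl⟩, _⟩; exact h i)⟩
  exact (Algebra.IsAlgebraic.isTranscendenceBasis_of_lift_le_trdeg_of_finite k w hu.lift_cardinalMk_eq_trdeg.le).1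

/-- Algebraically independent elements are infinitesimal for some valuation that is trivial on the
base field. -/
theorem exists_valuationSubring_of_algebraicIndependent {ι k L : Type*} [Field k] [Field L]
    [Algebra k L] {w : ι → L} (hw : AlgebraicIndependent k w) :
    ∃ A : ValuationSubring L, (∀ c : k, algebraMap k L c ∈ A) ∧ ∀ i, A.valuation (w i) < 1 := by
  let R := Algebra.adjoin k (Set.range w)
  -- Evaluation at w = 0; some valuation ring contains k[w] and has the kernel among its nonunits.
  let φ : R →+* k := MvPolynomial.constantCoeff.comp (hw.aevalEquiv.symm : R →+* MvPolynomial ι k)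
  obtain ⟨A, hRA, hA⟩ := Ideal.image_subset_nonunits_valuationSubring (A := R.toSubring)
    (RingHom.ker φ) (RingHom.ker_ne_top φ)
  refine ⟨A, fun c => hRA (R.algebraMap_mem c), fun i => ?_⟩
  rw [← ValuationSubring.mem_nonunits_iff]
  have hi : w i ∈ R := Algebra.subset_adjoin ⟨i, rfl⟩
  refine hA ⟨⟨w i, hi⟩, ?_, rfl⟩
  have : hw.aevalEquiv.symm ⟨w i, hi⟩ = MvPolynomial.X i := by
    rw [AlgEquiv.symm_apply_eq]
    ext
    simp
  change MvPolynomial.constantCoeff (hw.aevalEquiv.symm ⟨w i, hi⟩) = 0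
  rw [this, MvPolynomial.constantCoeff_X]

open Polynomial in
/-- Over a valuation ring of an algebraically closed field, the roots of the reduction of a
polynomial lift. -/
theorem exists_root_of_residue {L : Type*} [Field L] [IsAlgClosed L] (A : ValuationSubring L)
    (f : A[X]) (hf : f.map (IsLocalRing.residue A) ≠ 0) (r : A)
    (hr : IsLocalRing.residue A (f.eval r) = 0) :
    ∃ z : A, f.eval z = 0 ∧ IsLocalRing.residue A z = IsLocalRing.residue A r := by
  by_contra! hno
  let F : L[X] := f.map A.subtype
  have hinj : Function.Injective A.subtype := Subtype.val_injective
  -- If no integral root has the residue of r, then r - a is nonzero with integral inverse for every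
  -- root a, and X - a = (r - a)((r - a)⁻¹(X - r) + 1). Multiplying over the roots, f is f(r) times
  -- an integral polynomial, so its reduction would be zero.
  have key : ∀ s : Multiset L, (∀ a ∈ s, a ∈ F.roots) → ∃ P : A[X],
      (s.map fun a => X - C a).prod = C ((s.map fun a => X - C a).prod.eval (r : L)) *
        P.map A.subtype := by
    intro s
    induction s using Multiset.induction_on with
    | empty => intro _; exact ⟨1, by simp⟩
    | cons a s ih =>
      intro hs
      obtain ⟨P, hP⟩ := ih fun b hb => hs b (Multiset.mem_cons_of_mem hb)
      have ha : a ∈ F.roots := hs a (Multiset.mem_cons_self a s)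
      have hra : (r : L) - a ≠ 0 ∧ ((r : L) - a)⁻¹ ∈ A := by
        by_contra hcon
        have hlt : A.valuation ((r : L) - a) < 1 := by
          rw [← ValuationSubring.mem_nonunits_iff, ValuationSubring.mem_nonunits_iff_or]
          tauto
        have haA : a ∈ A := by
          have := A.sub_mem r.2 ((A.valuation_le_one_iff _).1 hlt.le)
          simpa using this
        refine hno ⟨a, haA⟩ ?_ ?_
        · apply hinj
          rw [map_zero, ← eval_map_apply]
          exact (mem_roots'.1 ha).2
        · symm
          rw [← sub_eq_zero, ← map_sub, IsLocalRing.residue_eq_zero_iff,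
            ValuationSubring.valuation_lt_one_iff]
          exact hlt
      refine ⟨(C (⟨_, hra.2⟩ : A) * (X - C r) + 1) * P, ?_⟩
      have e : (X - C a : L[X]) = C ((r : L) - a) *
          ((C (⟨_, hra.2⟩ : A) * (X - C r) + 1 : A[X]).map A.subtype) := by
        have h1 : C ((r : L) - a) * C ((r : L) - a)⁻¹ = 1 := by
          rw [← C_mul, mul_inv_cancel₀ hra.1, C_1]
        simp only [Polynomial.map_add, Polynomial.map_mul, Polynomial.map_sub, map_C, map_X,
          Polynomial.map_one, ValuationSubring.coe_subtype]
        rw [mul_add, ← mul_assoc, h1, C_sub]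
        ring
      rw [Multiset.map_cons, Multiset.prod_cons, eval_mul, C_mul, Polynomial.map_mul]
      conv_lhs => rw [hP, e]
      rw [eval_sub, eval_X, eval_C]
      ring
  obtain ⟨P, hP⟩ := key F.roots fun a ha => ha
  have hF : F = C F.leadingCoeff * (F.roots.map fun a => X - C a).prod :=
    (IsAlgClosed.splits F).eq_prod_roots
  have h2 : F = C (F.eval (r : L)) * P.map A.subtype := by
    conv_lhs => rw [hF, hP]
    conv_rhs => rw [hF]
    rw [eval_mul, eval_C, C_mul]
    ring
  have h3 : f = C (f.eval r) * P := by
    apply Polynomial.map_injective _ hinj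
    rw [Polynomial.map_mul, map_C]
    change F = _
    rw [h2]
    congr 2
    exact eval_map_apply A.subtype (r : A)
  apply hf
  rw [h3, Polynomial.map_mul, map_C, hr, C_0, zero_mul]

end Valuations

/-! ### Moving inside an orbit. -/

theorem mem_orbitOf_trans {d : ℕ} {F : Type*} [Field F] {S : Finset (Fin d → ℤ)}
    {u v w : Fin d → F} (huv : v ∈ orbitOf S u) (hvw : w ∈ orbitOf S v) : w ∈ orbitOf S u :=
  Relation.ReflTransGen.trans huv hvw

theorem stepPoly_eq_of_mem_orbitOf {d : ℕ} {F : Type*} [Field F] {S : Finset (Fin d → ℤ)}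
    {u v : Fin d → F} (h : v ∈ orbitOf S u) : stepPoly S v = stepPoly S u := by
  change Relation.ReflTransGen _ _ _ at h
  induction h with
  | refl => rfl
  | tail _ hadj ih =>
    obtain ⟨i, hi⟩ := hadj
    rw [← ih, hi.2.2.2.2]

/-- Adjacent points must be distinct; the case of equal points is absorbed by reflexivity. -/
theorem mem_orbitOf_of_eq {d : ℕ} {F : Type*} [Field F] {S : Finset (Fin d → ℤ)} (i : Fin d)
    {u v : Fin d → F} (hu : ∀ j, u j ≠ 0) (hv : ∀ j, v j ≠ 0) (huv : ∀ j, j ≠ i → u j = v j)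
    (h : stepPoly S u = stepPoly S v) : v ∈ orbitOf S u := by
  by_cases e : u = v
  · rw [e]; exact Relation.ReflTransGen.refl
  · exact Relation.ReflTransGen.single ⟨i, hu, hv, e, huv, h⟩


/-! ### Tropical dynamics: moves that make a step dominant. -/

section Tropical

variable {L : Type*} [Field L]

open Polynomial in
/-- If one monomial of the step polynomial equals `s` at `u` and is larger than all the others,
then the value `s` is taken at a point that differs from `u` by a unit factor in one coordinate. -/
theorem exists_stepPoly_eq_of_dominant [IsAlgClosed L] (A : ValuationSubring L) {d : ℕ}
    {S : Finset (Fin d → ℤ)} {u : Fin d → L} {s : L} (hs : s ≠ 0) {i : Fin d}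
    {e : Fin d → ℤ} (he : e ∈ S) (hei : e i ≠ 0) (hes : ∏ j, u j ^ e j = s)
    (hdom : ∀ f ∈ S, f ≠ e → A.valuation (∏ j, u j ^ f j) < A.valuation s) :
    ∃ W : L, A.valuation W = 1 ∧ stepPoly S (Function.update u i (u i * W)) = s := by
  classical
  -- A shift making all exponents of the unknown W nonnegative.
  let N : ℤ := ∑ f ∈ S, |f i|
  have hN : ∀ f ∈ S, 0 ≤ f i + N := fun f hf => by
    have h1 := Finset.single_le_sum (f := fun f : Fin d → ℤ => |f i|) (fun f _ => abs_nonneg _) hf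
    have h2 := neg_abs_le (f i)
    change |f i| ≤ N at h1
    linarith
  have hN0 : 0 ≤ N := Finset.sum_nonneg fun f _ => abs_nonneg _
  have hvs : 0 < A.valuation s := by simpa [zero_lt_iff] using hs
  have hc : ∀ f ∈ S, (∏ j, u j ^ f j) / s ∈ A := by
    intro f hf
    rw [← A.valuation_le_one_iff, map_div₀]
    by_cases hfe : f = e
    · rw [hfe, hes, div_self hvs.ne']
    · exact div_le_one_of_le₀ (hdom f hf hfe).le zero_le
  let c : (Fin d → ℤ) → A := fun f => if hf : (∏ j, u j ^ f j) / s ∈ A then ⟨_, hf⟩ else 0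
  have hcv : ∀ f ∈ S, (c f : L) = (∏ j, u j ^ f j) / s := fun f hf => by simp [c, hc f hf]
  have hce : c e = 1 := by
    apply Subtype.val_injective
    rw [hcv e he, hes, div_self hs]
    rfl
  have hcf : ∀ f ∈ S, f ≠ e → IsLocalRing.residue A (c f) = 0 := by
    intro f hf hfe
    rw [IsLocalRing.residue_eq_zero_iff, ValuationSubring.valuation_lt_one_iff, hcv f hf, map_div₀]
    exact (div_lt_one₀ hvs).2 (hdom f hf hfe)
  -- The equation for W, divided by s and multiplied by W^N. By dominance its reduction is W^(e i +
  -- N) - W^N, which is nonzero since e i ≠ 0 and has the root 1.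
  let P : A[X] := ∑ f ∈ S, C (c f) * X ^ (f i + N).toNat - X ^ N.toNat
  have hP : P.map (IsLocalRing.residue A) = X ^ (e i + N).toNat - X ^ N.toNat := by
    simp only [P, Polynomial.map_sub, Polynomial.map_sum, Polynomial.map_mul, map_C,
      Polynomial.map_pow, map_X]
    rw [Finset.sum_eq_single_of_mem e he fun f hf hfe => by rw [hcf f hf hfe]; simp, hce]
    simp
  have hne : (e i + N).toNat ≠ N.toNat := by
    have := hN e he
    omega
  obtain ⟨z, hz, hz1⟩ := exists_root_of_residue A P
    (by
      rw [hP, sub_ne_zero]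
      intro h
      have := congrArg natDegree h
      simp only [natDegree_X_pow] at this
      exact hne this) 1
    (by rw [← eval_map_apply, hP]; simp)
  have hzu : IsUnit z := by
    rw [← IsLocalRing.residue_ne_zero_iff_isUnit, hz1]
    simp
  have hz0 : (z : L) ≠ 0 := fun h => hzu.ne_zero (Subtype.val_injective h)
  refine ⟨z, (A.valuation_eq_one_iff z).1 hzu, ?_⟩
  have hz' : ∑ f ∈ S, (∏ j, u j ^ f j) / s * (z : L) ^ (f i + N) = (z : L) ^ N := by
    have h := congrArg Subtype.val hz
    simp only [P, eval_sub, eval_finsetSum, eval_mul, eval_C, eval_pow, eval_X] at h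
    have h' : ∑ f ∈ S, (c f : L) * (z : L) ^ (f i + N).toNat - (z : L) ^ N.toNat = 0 := by
      simpa using h
    rw [sub_eq_zero] at h'
    convert h' using 1
    · refine Finset.sum_congr rfl fun f hf => ?_
      rw [hcv f hf, ← zpow_natCast, Int.toNat_of_nonneg (hN f hf)]
    · rw [← zpow_natCast, Int.toNat_of_nonneg hN0]
  have hm : ∀ f : Fin d → ℤ, ∏ j, Function.update u i (u i * z) j ^ f j =
      (∏ j, u j ^ f j) * (z : L) ^ f i := by
    intro f
    rw [← Finset.mul_prod_erase _ _ (Finset.mem_univ i),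
      ← Finset.mul_prod_erase _ (fun j => u j ^ f j) (Finset.mem_univ i), Function.update_self,
      mul_zpow, Finset.prod_congr rfl fun j hj => by
        rw [Function.update_of_ne (Finset.ne_of_mem_erase hj)]]
    ring
  unfold stepPoly
  simp_rw [hm]
  have hzN : (z : L) ^ N ≠ 0 := zpow_ne_zero _ hz0
  apply mul_right_cancel₀ hzN
  calc (∑ f ∈ S, (∏ j, u j ^ f j) * (z : L) ^ f i) * (z : L) ^ N
      = s * ∑ f ∈ S, (∏ j, u j ^ f j) / s * (z : L) ^ (f i + N) := by
        rw [Finset.sum_mul, Finset.mul_sum]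
        refine Finset.sum_congr rfl fun f _ => ?_
        rw [zpow_add₀ hz0]
        field_simp
    _ = s * (z : L) ^ N := by rw [hz']

/-- `ε ^ n * h ^ m` is infinitesimal as soon as `1 < h` and `ε * h ^ 100 < 1`. -/
abbrev IsSmall (n m : ℤ) : Prop := (n = 0 ∧ m < 0) ∨ (0 < n ∧ m ≤ 100 * n)

section Group

variable {Γ : Type*} [LinearOrderedCommGroupWithZero Γ] {ε h : Γ}

theorem zpow_mul_zpow_lt_one (hh : 1 < h) (hεh : ε * h ^ (100 : ℤ) < 1) {n m : ℤ}
    (hnm : IsSmall n m) : ε ^ n * h ^ m < 1 := by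
  have hh0 : 0 < h := zero_lt_one.trans hh
  rcases hnm with ⟨rfl, hm⟩ | ⟨hn, hm⟩
  · rw [zpow_zero, one_mul]
    exact zpow_lt_one_of_neg₀ hh hm
  · calc ε ^ n * h ^ m ≤ ε ^ n * h ^ (100 * n) := by
          gcongr
          exact hh.le
      _ = (ε * h ^ (100 : ℤ)) ^ n := by rw [mul_zpow, zpow_mul]
      _ < 1 := by
          lift n to ℕ using hn.le
          rw [zpow_natCast]
          exact pow_lt_one₀ zero_le hεh (by omega)

end Group

variable (S : Finset (Fin 2 → ℤ)) (σ : ℤ)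

/-- At a point with coordinates of sizes `ε ^ a * h ^ b` and `ε ^ c * h ^ d`, the step `e` gives a
term of size `ε ^ σ` and the other steps give smaller terms. -/
abbrev IsDominant (e : Fin 2 → ℤ) (a b c d : ℤ) : Prop :=
  e ∈ S ∧ e 0 * a + e 1 * c = σ ∧ e 0 * b + e 1 * d = 0 ∧
    ∀ f ∈ S, f ≠ e → IsSmall (f 0 * a + f 1 * c - σ) (f 0 * b + f 1 * d)

variable {S σ}

theorem IsDominant.valuation_lt {Γ : Type*} [LinearOrderedCommGroupWithZero Γ] {v : Valuation L Γ}
    {ε h : Γ} (hε : 0 < ε) (hh : 1 < h) (hεh : ε * h ^ (100 : ℤ) < 1) {e : Fin 2 → ℤ}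
    {a b c d : ℤ} (hdom : IsDominant S σ e a b c d) {u : Fin 2 → L}
    (h0 : v (u 0) = ε ^ a * h ^ b) (h1 : v (u 1) = ε ^ c * h ^ d) :
    v (∏ j, u j ^ e j) = ε ^ σ ∧ ∀ f ∈ S, f ≠ e → v (∏ j, u j ^ f j) < ε ^ σ := by
  have hh0 : 0 < h := zero_lt_one.trans hh
  have hm : ∀ f : Fin 2 → ℤ, v (∏ j, u j ^ f j) =
      ε ^ σ * (ε ^ (f 0 * a + f 1 * c - σ) * h ^ (f 0 * b + f 1 * d)) := by
    intro f
    rw [Fin.prod_univ_two, map_mul, map_zpow₀, map_zpow₀, h0, h1, mul_zpow, mul_zpow, ← zpow_mul,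
      ← zpow_mul, ← zpow_mul, ← zpow_mul, mul_mul_mul_comm, ← zpow_add₀ hε.ne',
      ← zpow_add₀ hh0.ne', ← mul_assoc, ← zpow_add₀ hε.ne', add_sub_cancel, mul_comm (f 0),
      mul_comm (f 1), mul_comm (f 0), mul_comm (f 1)]
  obtain ⟨_, he1, he2, hf⟩ := hdom
  refine ⟨by rw [hm, he1, he2]; simp, fun f hfS hfe => ?_⟩
  rw [hm]
  exact mul_lt_of_lt_one_right (zpow_pos hε _) (zpow_mul_zpow_lt_one hh hεh (hf f hfS hfe))

theorem zpow_left_injective₀ {Γ : Type*} [LinearOrderedCommGroupWithZero Γ] {x y : Γ} {n : ℤ}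
    (hn : n ≠ 0) (hx : 0 < x) (hy : 0 < y) (h : x ^ n = y ^ n) : x = y := by
  wlog hn0 : 0 < n generalizing n
  · exact this (n := -n) (by omega) (by rw [zpow_neg, zpow_neg, h]) (by omega)
  lift n to ℕ using hn0.le
  rw [zpow_natCast, zpow_natCast] at h
  exact (pow_left_inj₀ hx.le hy.le (by omega)).1 h

theorem exists_zpow_eq [IsAlgClosed L] {a : L} (ha : a ≠ 0) {n : ℤ} (hn : n ≠ 0) :
    ∃ z : L, z ≠ 0 ∧ z ^ n = a := by
  wlog hn0 : 0 < n generalizing n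
  · obtain ⟨z, hz, h⟩ := this (n := -n) (by omega) (by omega)
    exact ⟨z⁻¹, inv_ne_zero hz, by rw [← h, inv_zpow, zpow_neg]⟩
  lift n to ℕ using hn0.le
  obtain ⟨z, hz⟩ := IsAlgClosed.exists_pow_nat_eq a (n := n) (by omega)
  refine ⟨z, ?_, by rw [zpow_natCast, hz]⟩
  rintro rfl
  rw [zero_pow (by omega)] at hz
  exact ha hz.symm

/-- Inside an orbit, one can change one coordinate so that a prescribed step becomes dominant. -/
theorem exists_mem_orbitOf_of_isDominant [IsAlgClosed L] {A : ValuationSubring L}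
    {ε h : A.ValueGroup} (hε : 0 < ε) (hh : 1 < h) (hεh : ε * h ^ (100 : ℤ) < 1)
    {e : Fin 2 → ℤ} {a b c d a' b' c' d' : ℤ} (hdom : IsDominant S σ e a' b' c' d')
    (hmove : (a' = a ∧ b' = b ∧ e 1 ≠ 0) ∨ (c' = c ∧ d' = d ∧ e 0 ≠ 0)) {u : Fin 2 → L}
    (hs : A.valuation (stepPoly S u) = ε ^ σ) (h0 : A.valuation (u 0) = ε ^ a * h ^ b)
    (h1 : A.valuation (u 1) = ε ^ c * h ^ d) :
    ∃ v ∈ orbitOf S u, A.valuation (v 0) = ε ^ a' * h ^ b' ∧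
      A.valuation (v 1) = ε ^ c' * h ^ d' := by
  have hh0 : 0 < h := zero_lt_one.trans hh
  have hpos : ∀ n m : ℤ, 0 < ε ^ n * h ^ m := fun n m => mul_pos (zpow_pos hε _) (zpow_pos hh0 _)
  have hu0 : u 0 ≠ 0 := by rw [← A.valuation.ne_zero_iff, h0]; exact (hpos _ _).ne'
  have hu1 : u 1 ≠ 0 := by rw [← A.valuation.ne_zero_iff, h1]; exact (hpos _ _).ne'
  have hu : ∀ j, u j ≠ 0 := Fin.forall_fin_two.2 ⟨hu0, hu1⟩
  have hs0 : stepPoly S u ≠ 0 := by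
    rw [← A.valuation.ne_zero_iff, hs]; exact (zpow_pos hε _).ne'
  have hdom' := hdom
  obtain ⟨heS, he1, he2, -⟩ := hdom'
  rcases hmove with ⟨rfl, rfl, hei⟩ | ⟨rfl, rfl, hei⟩
  -- Choose z so that the monomial of e alone equals s. This forces the prescribed size, and a unit
  -- factor W then makes the whole sum equal to s.
  · obtain ⟨z, hz0, hz⟩ := exists_zpow_eq (div_ne_zero hs0 (zpow_ne_zero (e 0) hu0)) hei
    have hvz : A.valuation z = ε ^ c' * h ^ d' := by
      apply zpow_left_injective₀ hei (by simpa [zero_lt_iff] using hz0) (hpos _ _)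
      rw [← map_zpow₀, hz, map_div₀, map_zpow₀, hs, h0, div_eq_iff (zpow_pos (hpos _ _) _).ne',
        mul_zpow, mul_zpow, ← zpow_mul, ← zpow_mul, ← zpow_mul, ← zpow_mul, mul_mul_mul_comm,
        ← zpow_add₀ hε.ne', ← zpow_add₀ hh0.ne', mul_comm c', mul_comm d', mul_comm a',
        mul_comm b', add_comm (e 1 * c'), add_comm (e 1 * d'), he1, he2, zpow_zero, mul_one]
    let w : Fin 2 → L := ![u 0, z]
    have hw := hdom.valuation_lt hε hh hεh (u := w) h0 hvz
    obtain ⟨W, hW, hSW⟩ := exists_stepPoly_eq_of_dominant A (S := S) (u := w)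
      hs0 (i := 1) heS hei
      (by
        rw [Fin.prod_univ_two]
        change u 0 ^ e 0 * z ^ e 1 = _
        rw [hz, mul_div_cancel₀ _ (zpow_ne_zero _ hu0)])
      (by rw [hs]; exact hw.2)
    have hW0 : W ≠ 0 := by rw [← A.valuation.ne_zero_iff, hW]; exact one_ne_zero
    refine ⟨_, mem_orbitOf_of_eq 1 hu ?_ ?_ hSW.symm, ?_, ?_⟩
    · exact Fin.forall_fin_two.2 ⟨by simpa [w] using hu0, by simp [w, hz0, hW0]⟩
    · intro j hj
      obtain rfl : j = 0 := by omega
      simp [w]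
    · simpa [w] using h0
    · simp [w, hW, hvz]
  · obtain ⟨z, hz0, hz⟩ := exists_zpow_eq (div_ne_zero hs0 (zpow_ne_zero (e 1) hu1)) hei
    have hvz : A.valuation z = ε ^ a' * h ^ b' := by
      apply zpow_left_injective₀ hei (by simpa [zero_lt_iff] using hz0) (hpos _ _)
      rw [← map_zpow₀, hz, map_div₀, map_zpow₀, hs, h1, div_eq_iff (zpow_pos (hpos _ _) _).ne',
        mul_zpow, mul_zpow, ← zpow_mul, ← zpow_mul, ← zpow_mul, ← zpow_mul, mul_mul_mul_comm,
        ← zpow_add₀ hε.ne', ← zpow_add₀ hh0.ne', mul_comm c', mul_comm d', mul_comm a',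
        mul_comm b', he1, he2, zpow_zero, mul_one]
    let w : Fin 2 → L := ![z, u 1]
    have hw := hdom.valuation_lt hε hh hεh (u := w) hvz h1
    obtain ⟨W, hW, hSW⟩ := exists_stepPoly_eq_of_dominant A (S := S) (u := w)
      hs0 (i := 0) heS hei
      (by
        rw [Fin.prod_univ_two]
        change z ^ e 0 * u 1 ^ e 1 = _
        rw [hz, div_mul_cancel₀ _ (zpow_ne_zero _ hu1)])
      (by rw [hs]; exact hw.2)
    have hW0 : W ≠ 0 := by rw [← A.valuation.ne_zero_iff, hW]; exact one_ne_zero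
    refine ⟨_, mem_orbitOf_of_eq 0 hu ?_ ?_ hSW.symm, ?_, ?_⟩
    · exact Fin.forall_fin_two.2 ⟨by simp [w, hz0, hW0], by simpa [w] using hu1⟩
    · intro j hj
      obtain rfl : j = 1 := by omega
      simp [w]
    · simp [w, hW, hvz]
    · simpa [w] using h1

end Tropical

/-- In a finite set, f would reach a minimum on the elements satisfying `Q`. -/
theorem _root_.Set.infinite_of_forall_exists_lt_of_pred {α β : Type*} [LinearOrder β] {T : Set α}
    (Q : α → Prop) (f : α → β) {x : α} (hx : x ∈ T) (hQx : Q x)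
    (step : ∀ x ∈ T, Q x → ∃ y ∈ T, Q y ∧ f y < f x) : T.Infinite := by
  intro hT
  obtain ⟨y, hy, hmin⟩ := Set.exists_min_image {x ∈ T | Q x} f (hT.subset (Set.sep_subset _ _))
    ⟨x, hx, hQx⟩
  obtain ⟨z, hz, hQz, hlt⟩ := step y hy.1 hy.2
  exact absurd (hmin z ⟨hz, hQz⟩) (not_le.2 hlt)

section Tropical

/-- The exponents `(a, b, c, d)` stand for points with coordinates of sizes `ε ^ a * h ^ b` and
`ε ^ c * h ^ d`; two of them are related if one coordinate is the same and some step is dominant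
at the second one. -/
def TropicalMove (S : Finset (Fin 2 → ℤ)) (σ : ℤ) (p q : ℤ × ℤ × ℤ × ℤ) : Prop :=
  ∃ e, IsDominant S σ e q.1 q.2.1 q.2.2.1 q.2.2.2 ∧
    ((q.1 = p.1 ∧ q.2.1 = p.2.1 ∧ e 1 ≠ 0) ∨
      (q.2.2.1 = p.2.2.1 ∧ q.2.2.2 = p.2.2.2 ∧ e 0 ≠ 0))

variable {L : Type*} [Field L] {S : Finset (Fin 2 → ℤ)} {σ : ℤ}

theorem exists_mem_orbitOf_of_reflTransGen [IsAlgClosed L] {A : ValuationSubring L} {ε h : A.ValueGroup}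
    (hε : 0 < ε) (hh : 1 < h) (hεh : ε * h ^ (100 : ℤ) < 1) {p q : ℤ × ℤ × ℤ × ℤ}
    (hpq : Relation.ReflTransGen (TropicalMove S σ) p q) {u : Fin 2 → L}
    (hs : A.valuation (stepPoly S u) = ε ^ σ) (h0 : A.valuation (u 0) = ε ^ p.1 * h ^ p.2.1)
    (h1 : A.valuation (u 1) = ε ^ p.2.2.1 * h ^ p.2.2.2) :
    ∃ v ∈ orbitOf S u, A.valuation (v 0) = ε ^ q.1 * h ^ q.2.1 ∧
      A.valuation (v 1) = ε ^ q.2.2.1 * h ^ q.2.2.2 := by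
  induction hpq with
  | refl => exact ⟨u, Relation.ReflTransGen.refl, h0, h1⟩
  | tail _ hmove ih =>
    obtain ⟨v, hv, hv0, hv1⟩ := ih
    obtain ⟨e, hdom, hmv⟩ := hmove
    obtain ⟨w, hw, hw0, hw1⟩ := exists_mem_orbitOf_of_isDominant hε hh hεh hdom hmv
      (by rw [stepPoly_eq_of_mem_orbitOf hv, hs]) hv0 hv1
    exact ⟨w, mem_orbitOf_trans hv hw, hw0, hw1⟩

theorem valuation_stepPoly_of_isDominant {A : ValuationSubring L} {ε h : A.ValueGroup}
    (hε : 0 < ε) (hh : 1 < h) (hεh : ε * h ^ (100 : ℤ) < 1) {e : Fin 2 → ℤ} {a b c d : ℤ}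
    (hdom : IsDominant S σ e a b c d) {u : Fin 2 → L}
    (h0 : A.valuation (u 0) = ε ^ a * h ^ b) (h1 : A.valuation (u 1) = ε ^ c * h ^ d) :
    A.valuation (stepPoly S u) = ε ^ σ := by
  classical
  obtain ⟨he, hlt⟩ := hdom.valuation_lt hε hh hεh h0 h1
  rw [stepPoly, ← Finset.add_sum_erase _ _ hdom.1, Valuation.map_add_eq_of_lt_left, he]
  rw [he]
  refine Valuation.map_sum_lt _ (zpow_pos hε _).ne' fun f hf => ?_
  exact hlt f (Finset.mem_of_mem_erase hf) (Finset.ne_of_mem_erase hf)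

/-- Generic points whose sizes are prescribed monomials in infinitesimals `ε` and `h⁻¹`. -/
theorem exists_valuation_eq_monomials [IsAlgClosed L] [Algebra ℂ L] {u : Fin 2 → L}
    (hu : IsTranscendenceBasis ℂ u) {a b c d : ℤ} (hD : a * d - b * c ≠ 0) :
    ∃ (A : ValuationSubring L) (ε h : A.ValueGroup), 0 < ε ∧ 1 < h ∧ ε * h ^ (100 : ℤ) < 1 ∧
      A.valuation (u 0) = ε ^ a * h ^ b ∧ A.valuation (u 1) = ε ^ c * h ^ d := by
  have hu0 : u 0 ≠ 0 := hu.1.ne_zero 0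
  have hu1 : u 1 ≠ 0 := hu.1.ne_zero 1
  -- δ is the sign of the determinant, n its absolute value.
  obtain ⟨δ, n, hn, hδ⟩ : ∃ δ n : ℤ, 0 < n ∧ δ * (a * d - b * c) = n := by
    rcases lt_or_gt_of_ne hD with h | h
    · exact ⟨-1, -(a * d - b * c), by omega, by ring⟩
    · exact ⟨1, a * d - b * c, by omega, by ring⟩
  -- Inverting the exponent matrix up to its determinant: E and H will be the n-th powers of
  -- elements of sizes ε and h.
  let E : L := u 0 ^ (δ * d) * u 1 ^ (-(δ * b))
  let H : L := u 0 ^ (-(δ * c)) * u 1 ^ (δ * a)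
  have hE0 : E ≠ 0 := mul_ne_zero (zpow_ne_zero _ hu0) (zpow_ne_zero _ hu1)
  have hH0 : H ≠ 0 := mul_ne_zero (zpow_ne_zero _ hu0) (zpow_ne_zero _ hu1)
  have hx : u 0 ^ n = E ^ a * H ^ b := by
    simp only [E, H, mul_zpow, ← zpow_mul]
    rw [mul_mul_mul_comm, ← zpow_add₀ hu0, ← zpow_add₀ hu1,
      show δ * d * a + -(δ * c) * b = n by linear_combination hδ,
      show -(δ * b) * a + δ * a * b = 0 by ring, zpow_zero, mul_one]
  have hy : u 1 ^ n = E ^ c * H ^ d := by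
    simp only [E, H, mul_zpow, ← zpow_mul]
    rw [mul_mul_mul_comm, ← zpow_add₀ hu0, ← zpow_add₀ hu1,
      show δ * d * c + -(δ * c) * d = 0 by ring,
      show -(δ * b) * c + δ * a * d = n by linear_combination hδ, zpow_zero, one_mul]
  -- These being infinitesimal is what gives 1 < h and ε h^100 < 1.
  have hw : AlgebraicIndependent ℂ ![H⁻¹, E * H ^ (100 : ℤ)] := by
    apply algebraicIndependent_of_isAlgebraic hu
    set R := Algebra.adjoin ℂ (Set.range ![H⁻¹, E * H ^ (100 : ℤ)])
    have hz : ∀ (z : L) (m : ℤ), IsAlgebraic R z → IsAlgebraic R (z ^ m) := by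
      intro z m h
      cases m with
      | ofNat m => simpa using h.pow m
      | negSucc m => simpa using (h.pow (m + 1)).inv
    have hH : IsAlgebraic R H := by
      have : IsAlgebraic R H⁻¹ :=
        isAlgebraic_algebraMap (⟨H⁻¹, Algebra.subset_adjoin ⟨0, rfl⟩⟩ : R)
      simpa using this.inv
    have hE : IsAlgebraic R E := by
      have : IsAlgebraic R (E * H ^ (100 : ℤ)) :=
        isAlgebraic_algebraMap (⟨_, Algebra.subset_adjoin ⟨1, rfl⟩⟩ : R)
      have h2 := this.mul (hz H (-100) hH)
      rwa [mul_assoc, ← zpow_add₀ hH0, add_neg_cancel, zpow_zero, mul_one] at h2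
    have hroot : ∀ z : L, IsAlgebraic R (z ^ n) → IsAlgebraic R z := by
      intro z h
      lift n to ℕ using hn.le
      rw [zpow_natCast] at h
      exact h.of_pow (by omega)
    rw [Fin.forall_fin_two]
    exact ⟨hroot _ (hx ▸ (hz _ _ hE).mul (hz _ _ hH)), hroot _ (hy ▸ (hz _ _ hE).mul (hz _ _ hH))⟩
  obtain ⟨A, -, hA⟩ := exists_valuationSubring_of_algebraicIndependent hw
  obtain ⟨e, he0, he⟩ := exists_zpow_eq hE0 hn.ne'
  obtain ⟨g, hg0, hg⟩ := exists_zpow_eq hH0 hn.ne'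
  have hε : 0 < A.valuation e := by simpa [zero_lt_iff] using he0
  have hh0 : 0 < A.valuation g := by simpa [zero_lt_iff] using hg0
  have hlt : ∀ {x : A.ValueGroup}, x ^ n < 1 → x < 1 := by
    intro x h
    by_contra hx
    exact absurd h (not_lt.2 (one_le_zpow₀ (not_lt.1 hx) hn.le))
  refine ⟨A, A.valuation e, A.valuation g, hε, ?_, ?_, ?_, ?_⟩
  · have h1 : A.valuation H⁻¹ < 1 := hA 0
    rw [← hg, ← inv_zpow, map_zpow₀, map_inv₀] at h1
    exact (inv_lt_one₀ hh0).1 (hlt h1)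
  · have h1 : A.valuation (E * H ^ (100 : ℤ)) < 1 := hA 1
    apply hlt
    rwa [← hg, ← he, ← zpow_mul, mul_comm n, zpow_mul, ← mul_zpow, map_zpow₀, map_mul,
      map_zpow₀] at h1
  · apply zpow_left_injective₀ hn.ne' (by simpa [zero_lt_iff] using hu0)
      (mul_pos (zpow_pos hε _) (zpow_pos hh0 _))
    rw [← map_zpow₀, hx, ← he, ← hg, map_mul, mul_zpow, ← zpow_mul, ← zpow_mul, map_zpow₀,
      map_zpow₀, ← zpow_mul, ← zpow_mul, mul_comm n, mul_comm n]
  · apply zpow_left_injective₀ hn.ne' (by simpa [zero_lt_iff] using hu1)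
      (mul_pos (zpow_pos hε _) (zpow_pos hh0 _))
    rw [← map_zpow₀, hy, ← he, ← hg, map_mul, mul_zpow, ← zpow_mul, ← zpow_mul, map_zpow₀,
      map_zpow₀, ← zpow_mul, ← zpow_mul, mul_comm n, mul_comm n]

/-- An orbit is infinite when the tropical dynamics has a contracting cycle. -/
theorem infinite_orbitOf_of_contracting_cycle [IsAlgClosed L] [Algebra ℂ L] {u : Fin 2 → L}
    (hu : IsTranscendenceBasis ℂ u) (e : Fin 2 → ℤ) (a b c d m : ℤ)
    (hdom : IsDominant S σ e a (m * b) c (m * d))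
    (hcycle : Relation.ReflTransGen (TropicalMove S σ) (a, m * b, c, m * d) (a, b, c, d))
    (hb : 0 < b) (hm : 1 < m) (hD : a * (m * d) - m * b * c ≠ 0) : (orbitOf S u).Infinite := by
  obtain ⟨A, ε, h, hε, hh, hεh, h0, h1⟩ := exists_valuation_eq_monomials hu hD
  have hs := valuation_stepPoly_of_isDominant hε hh hεh hdom h0 h1
  -- The valuation and ε stay fixed; only g, in the role of h, varies.
  let Q : (Fin 2 → L) → Prop := fun v => ∃ g : A.ValueGroup, 1 < g ∧ ε * g ^ (100 : ℤ) < 1 ∧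
    A.valuation (v 0) = ε ^ a * g ^ (m * b) ∧ A.valuation (v 1) = ε ^ c * g ^ (m * d)
  refine Set.infinite_of_forall_exists_lt_of_pred Q (fun v => A.valuation (v 0))
    (x := u) Relation.ReflTransGen.refl ⟨h, hh, hεh, h0, h1⟩ ?_
  rintro v hv ⟨g, hg, hεg, hv0, hv1⟩
  obtain ⟨w, hw, hw0, hw1⟩ := exists_mem_orbitOf_of_reflTransGen hε hg hεg hcycle
    (by rw [stepPoly_eq_of_mem_orbitOf hv, hs]) hv0 hv1
  have hg0 : 0 < g := zero_lt_one.trans hg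
  obtain ⟨G, hG⟩ := A.valuation_surjective g
  -- With z^m = G, the end of the cycle for g is its start for the size of z, which lies between 1
  -- and g, so the bound on ε persists.
  obtain ⟨z, hz0, hz⟩ := exists_zpow_eq (a := G) (n := m)
    (by rw [← A.valuation.ne_zero_iff, hG]; exact hg0.ne') (by omega)
  have hzg : A.valuation z ^ m = g := by rw [← map_zpow₀, hz, hG]
  have hz1 : 1 < A.valuation z := by
    by_contra hle
    refine absurd hg (not_lt.2 ?_)
    rw [← hzg]
    lift m to ℕ using (by omega)
    rw [zpow_natCast]
    exact pow_le_one₀ zero_le (not_lt.1 hle)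
  have hzle : A.valuation z ≤ g := by
    calc A.valuation z = A.valuation z ^ (1 : ℤ) := (zpow_one _).symm
      _ ≤ A.valuation z ^ m := zpow_le_zpow_right₀ hz1.le hm.le
      _ = g := hzg
  refine ⟨w, mem_orbitOf_trans hv hw, ⟨A.valuation z, hz1, ?_, ?_, ?_⟩, ?_⟩
  · refine lt_of_le_of_lt ?_ hεg
    have hpow : ∀ k : ℕ, ε * A.valuation z ^ (k : ℤ) ≤ ε * g ^ (k : ℤ) := by
      intro k
      rw [zpow_natCast, zpow_natCast]
      gcongr
    exact hpow 100
  · rw [zpow_mul, hzg, hw0]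
  · rw [zpow_mul, hzg, hw1]
  · rw [hw0, hv0]
    apply mul_lt_mul_of_pos_left _ (zpow_pos hε _)
    exact zpow_lt_zpow_right₀ hg (by nlinarith)

end Tropical

/-! ### Contracting cycles for twelve models. -/

section TropicalModels

variable {L : Type*} [Field L] [IsAlgClosed L] [Algebra ℂ L] {u : Fin 2 → L}

/-- With both coordinates of order ε, the steps (-2,1) and (1,-2) tie at ε⁻¹ and h breaks the tie.
Each move makes the h-exponent of the moved coordinate half that of the other, whence the factor 4.
-/
theorem infinite_orbitOf_model_one (hu : IsTranscendenceBasis ℂ u) :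
    (orbitOf {![-2, 1], ![0, 1], ![1, -2]} u).Infinite := by
  refine infinite_orbitOf_of_contracting_cycle (σ := -1) hu ![-2, 1] (1) (1) (1) (2) 4 (by decide) ?_
    (by decide) (by decide) (by decide)
  refine .head (b := (1, 4, 1, 2)) ⟨![1, -2], by decide, by decide⟩ ?_
  exact .single ⟨![-2, 1], by decide, by decide⟩

theorem infinite_orbitOf_model_two (hu : IsTranscendenceBasis ℂ u) :
    (orbitOf {![-2, 1], ![1, -2], ![1, 1]} u).Infinite := by
  refine infinite_orbitOf_of_contracting_cycle (σ := -1) hu ![-2, 1] (1) (1) (1) (2) 4 (by decide) ?_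
    (by decide) (by decide) (by decide)
  refine .head (b := (1, 4, 1, 2)) ⟨![1, -2], by decide, by decide⟩ ?_
  exact .single ⟨![-2, 1], by decide, by decide⟩

/-- The orders (2,3) make (-2,1) and (1,-1) tie at ε⁻¹. Only the move by (-2,1) halves an
h-exponent, whence the factor 2. -/
theorem infinite_orbitOf_model_three (hu : IsTranscendenceBasis ℂ u) :
    (orbitOf {![-2, 1], ![1, -1], ![1, 0]} u).Infinite := by
  refine infinite_orbitOf_of_contracting_cycle (σ := -1) hu ![-2, 1] (2) (1) (3) (2) 2 (by decide) ?_
    (by decide) (by decide) (by decide)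
  refine .head (b := (2, 2, 3, 2)) ⟨![1, -1], by decide, by decide⟩ ?_
  exact .single ⟨![-2, 1], by decide, by decide⟩

theorem infinite_orbitOf_model_four (hu : IsTranscendenceBasis ℂ u) :
    (orbitOf {![-2, 1], ![1, -1], ![1, 1]} u).Infinite := by
  refine infinite_orbitOf_of_contracting_cycle (σ := -1) hu ![-2, 1] (2) (1) (3) (2) 2 (by decide) ?_
    (by decide) (by decide) (by decide)
  refine .head (b := (2, 2, 3, 2)) ⟨![1, -1], by decide, by decide⟩ ?_
  exact .single ⟨![-2, 1], by decide, by decide⟩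

theorem infinite_orbitOf_model_five (hu : IsTranscendenceBasis ℂ u) :
    (orbitOf {![-2, -1], ![1, -1], ![1, 1]} u).Infinite := by
  refine infinite_orbitOf_of_contracting_cycle (σ := -1) hu ![-2, -1] (2) (1) (-3) (-2) 2 (by decide) ?_
    (by decide) (by decide) (by decide)
  refine .head (b := (2, 2, -3, -2)) ⟨![1, 1], by decide, by decide⟩ ?_
  exact .single ⟨![-2, -1], by decide, by decide⟩

theorem infinite_orbitOf_model_six (hu : IsTranscendenceBasis ℂ u) :
    (orbitOf {![-2, -1], ![1, 0], ![1, 1]} u).Infinite := by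
  refine infinite_orbitOf_of_contracting_cycle (σ := -1) hu ![-2, -1] (2) (1) (-3) (-2) 2 (by decide) ?_
    (by decide) (by decide) (by decide)
  refine .head (b := (2, 2, -3, -2)) ⟨![1, 1], by decide, by decide⟩ ?_
  exact .single ⟨![-2, -1], by decide, by decide⟩

theorem infinite_orbitOf_model_seven (hu : IsTranscendenceBasis ℂ u) :
    (orbitOf {![-2, 1], ![-1, 1], ![0, 1], ![1, -1]} u).Infinite := by
  refine infinite_orbitOf_of_contracting_cycle (σ := -1) hu ![-2, 1] (2) (1) (3) (2) 2 (by decide) ?_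
    (by decide) (by decide) (by decide)
  refine .head (b := (2, 2, 3, 2)) ⟨![1, -1], by decide, by decide⟩ ?_
  exact .single ⟨![-2, 1], by decide, by decide⟩

theorem infinite_orbitOf_model_eight (hu : IsTranscendenceBasis ℂ u) :
    (orbitOf {![-2, -1], ![-1, -1], ![0, -1], ![1, 1]} u).Infinite := by
  refine infinite_orbitOf_of_contracting_cycle (σ := -1) hu ![-2, -1] (2) (1) (-3) (-2) 2 (by decide) ?_
    (by decide) (by decide) (by decide)
  refine .head (b := (2, 2, -3, -2)) ⟨![1, 1], by decide, by decide⟩ ?_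
  exact .single ⟨![-2, -1], by decide, by decide⟩

theorem infinite_orbitOf_model_thirteen (hu : IsTranscendenceBasis ℂ u) :
    (orbitOf {![-2, 1], ![-1, 0], ![0, -1], ![0, 1], ![1, -2], ![1, 0]} u).Infinite := by
  refine infinite_orbitOf_of_contracting_cycle (σ := -1) hu ![-2, 1] (1) (1) (1) (2) 4 (by decide) ?_
    (by decide) (by decide) (by decide)
  refine .head (b := (1, 4, 1, 2)) ⟨![1, -2], by decide, by decide⟩ ?_
  exact .single ⟨![-2, 1], by decide, by decide⟩

theorem infinite_orbitOf_model_fourteen (hu : IsTranscendenceBasis ℂ u) :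
    (orbitOf {![-2, 1], ![-1, 0], ![0, 1], ![1, -2], ![1, -1], ![1, 1]} u).Infinite := by
  refine infinite_orbitOf_of_contracting_cycle (σ := -1) hu ![-2, 1] (1) (1) (1) (2) 4 (by decide) ?_
    (by decide) (by decide) (by decide)
  refine .head (b := (1, 4, 1, 2)) ⟨![1, -2], by decide, by decide⟩ ?_
  exact .single ⟨![-2, 1], by decide, by decide⟩

/-- This cycle has four moves and passes through several pairs of ε-exponents, the dominant term
always having order ε⁻³. The moves by (1,-2) and (-2,-1) each halve an h-exponent in absolute value;
the other two preserve it. -/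
theorem infinite_orbitOf_model_fifteen (hu : IsTranscendenceBasis ℂ u) :
    (orbitOf {![-2, -1], ![-1, 1], ![0, 1], ![1, -2], ![1, 0], ![1, 1]} u).Infinite := by
  refine infinite_orbitOf_of_contracting_cycle (σ := -3) hu ![1, 1] (-1) (1) (-2) (-1) 4 (by decide) ?_
    (by decide) (by decide) (by decide)
  refine .head (b := (-1, 4, 1, 2)) ⟨![1, -2], by decide, by decide⟩ ?_
  refine .head (b := (1, -1, 1, 2)) ⟨![-2, -1], by decide, by decide⟩ ?_
  refine .head (b := (1, -1, -2, -1)) ⟨![-1, 1], by decide, by decide⟩ ?_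
  exact .single ⟨![1, 1], by decide, by decide⟩

theorem infinite_orbitOf_model_sixteen (hu : IsTranscendenceBasis ℂ u) :
    (orbitOf {![-2, 1], ![-1, 0], ![-1, 1], ![0, -1], ![0, 1], ![1, -2], ![1, -1], ![1, 0], ![1, 1]} u).Infinite := by
  refine infinite_orbitOf_of_contracting_cycle (σ := -1) hu ![-2, 1] (1) (1) (1) (2) 4 (by decide) ?_
    (by decide) (by decide) (by decide)
  refine .head (b := (1, 4, 1, 2)) ⟨![1, -2], by decide, by decide⟩ ?_
  exact .single ⟨![-2, 1], by decide, by decide⟩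

end TropicalModels


/-! ### Linearised dynamics at a complex critical point. -/

section Critical

open IsLocalRing

/-- A polynomial of degree two whose reduction has degree one has a root lifting the root of its
reduction. -/
theorem exists_root_of_linear_residue {L : Type*} [Field L] [IsAlgClosed L]
    {A : ValuationSubring L} {t c₂ c₁ c₀ z : A} (ht : residue A t = 0) (hc : residue A c₁ ≠ 0)
    (hz : residue A c₁ * residue A z + residue A c₀ = 0) :
    ∃ W : A, t * c₂ * W ^ 2 + c₁ * W + c₀ = 0 ∧ residue A W = residue A z := by
  obtain ⟨W, hW, hWz⟩ := exists_root_of_residue A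
    (Polynomial.C (t * c₂) * Polynomial.X ^ 2 + Polynomial.C c₁ * Polynomial.X + Polynomial.C c₀)
    (by
      intro h
      apply hc
      simpa [ht, Polynomial.coeff_X, Polynomial.coeff_C] using congrArg (Polynomial.coeff · 1) h) z
    (by simp [ht, hz])
  exact ⟨W, by simpa using hW, hWz⟩

theorem add_infinitesimal_ne_zero {L : Type*} [Field L] {A : ValuationSubring L} (α : ℂ →+* A)
    {a : ℂ} (ha : a ≠ 0) {t : A} (ht : residue A t = 0) (X : A) : ((α a + t * X : A) : L) ≠ 0 := by
  intro h
  have h0 : (α a + t * X : A) = 0 := Subtype.val_injective h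
  have h1 := congrArg (residue A) h0
  rw [map_add, map_mul, ht, zero_mul, add_zero, map_zero] at h1
  exact ha ((map_eq_zero ((residue A).comp α)).1 h1)

/-- On the unit circle 1/l is the conjugate of l, so τ = l + 1/l + 2 would be real. -/
theorem norm_ne_one_of_im_ne_zero {l τ : ℂ} (h : (1 + l) ^ 2 = τ * l) (hτ : τ.im ≠ 0) :
    ‖l‖ ≠ 1 := by
  intro hl
  have hl0 : l ≠ 0 := by rintro rfl; simp at hl
  have hconj : l * starRingEnd ℂ l = 1 := by
    rw [Complex.mul_conj, Complex.normSq_eq_norm_sq, hl]; simp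
  have h2 : τ = l + starRingEnd ℂ l + 2 := by
    apply mul_right_cancel₀ hl0
    rw [← h]
    linear_combination - hconj
  apply hτ
  rw [h2]
  simp

variable {L : Type*} [Field L] [Algebra ℂ L] {S : Finset (Fin 2 → ℤ)}
  {u : Fin 2 → L}

/-- The orbit is infinite if, near a nondegenerate complex critical point `(a, b)`, the
composition of the linear parts of the two involutions of the level sets of `S` has a nonreal
trace. These involutions are given on the tangent space by `η' = -η - (p / q) ξ` and
`ξ' = -ξ - (p' / q') η`. -/
theorem infinite_orbitOf_of_critical (hu : IsTranscendenceBasis ℂ u) {a b p q p' q' : ℂ}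
    (ha : a ≠ 0) (hb : b ≠ 0) (hq : q ≠ 0) (hq' : q' ≠ 0) (hτ : (p * p' / (q * q')).im ≠ 0)
    (hV : ∀ (A : ValuationSubring L) (α : ℂ →+* A) (t X Y Z : A), residue A t = 0 →
      residue A (α p * X + α q * (Y + Z)) = 0 → ∃ W : A, residue A W = residue A Z ∧
        stepPoly S ![((α a + t * X : A) : L), (α b + t * Y : A)] =
          stepPoly S ![((α a + t * X : A) : L), (α b + t * W : A)])
    (hH : ∀ (A : ValuationSubring L) (α : ℂ →+* A) (t X Y Z : A), residue A t = 0 →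
      residue A (α p' * Y + α q' * (X + Z)) = 0 → ∃ W : A, residue A W = residue A Z ∧
        stepPoly S ![((α a + t * X : A) : L), (α b + t * Y : A)] =
          stepPoly S ![((α a + t * W : A) : L), (α b + t * Y : A)]) :
    (orbitOf S u).Infinite := by
  have hp : p ≠ 0 := by rintro rfl; simp at hτ
  have hp' : p' ≠ 0 := by rintro rfl; simp at hτ
  -- the slopes of the two branches of the level set at the critical point
  obtain ⟨κ, hκ⟩ := IsAlgClosed.exists_root
    (Polynomial.X ^ 2 + Polynomial.C (p / q) * Polynomial.X +
      Polynomial.C (p * q' / (q * p')) : Polynomial ℂ) (by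
      have : (Polynomial.X ^ 2 + Polynomial.C (p / q) * Polynomial.X +
        Polynomial.C (p * q' / (q * p')) : Polynomial ℂ).degree = 2 := by compute_degree!
      rw [this]; decide)
  have hκ' : κ ^ 2 + p / q * κ + p * q' / (q * p') = 0 := by simpa using hκ
  obtain ⟨κ₂, hκ₂⟩ : ∃ κ₂, κ₂ = -(p / q) - κ := ⟨_, rfl⟩
  have hprod : κ * κ₂ = p * q' / (q * p') := by rw [hκ₂]; linear_combination -hκ'
  have hπ : κ * κ₂ ≠ 0 := by
    rw [hprod]; exact div_ne_zero (mul_ne_zero hp hq') (mul_ne_zero hq hp')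
  have hκ0 : κ ≠ 0 := left_ne_zero_of_mul hπ
  have hκ₂0 : κ₂ ≠ 0 := right_ne_zero_of_mul hπ
  -- The vertical involution sends (1, κ) to (1, κ₂), and the horizontal one sends (1, κ₂) to (l,
  -- κ₂) = l (1, κ) with l = κ₂ / κ. So (1, κ) is an eigenvector of the composition.
  have hv : p + q * (κ + κ₂) = 0 := by rw [hκ₂]; field_simp; ring
  have hh : p' * κ₂ + q' * (1 + κ₂ / κ) = 0 := by
    have h1 : κ * κ₂ * (q * p') = p * q' := by rw [hprod]; field_simp
    field_simp
    apply mul_left_cancel₀ hq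
    linear_combination h1 + q' * hv
  set l := κ₂ / κ with hl
  have hl0 : l ≠ 0 := div_ne_zero hκ₂0 hκ0
  have hlκ : l * κ = κ₂ := by rw [hl]; field_simp
  have hl1 : ‖l‖ ≠ 1 := by
    refine norm_ne_one_of_im_ne_zero (τ := p * p' / (q * q')) ?_ hτ
    have h1 : κ * (1 + l) = -(p / q) := by
      field_simp
      linear_combination hv + q * hlκ
    have h2 : 1 + l = -(p' / q') * (l * κ) := by
      field_simp
      linear_combination hh + p' * hlκ
    have : κ * (1 + l) ^ 2 = κ * (p * p' / (q * q') * l) := by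
      calc κ * (1 + l) ^ 2 = (κ * (1 + l)) * (1 + l) := by ring
        _ = -(p / q) * (-(p' / q') * (l * κ)) := by rw [h1, ← h2]
        _ = _ := by field_simp
    exact mul_left_cancel₀ hκ0 this
  -- a valuation centered at the critical point, with a tangent direction
  have hne : u 0 - algebraMap ℂ L a ≠ 0 := by
    intro h
    have ht : Transcendental ℂ (u 0) := hu.1.transcendental 0
    apply ht
    rw [sub_eq_zero.1 h]
    exact isAlgebraic_algebraMap a
  let w : Fin 2 → L := ![u 0 - algebraMap ℂ L a,
    (u 1 - algebraMap ℂ L b) / (u 0 - algebraMap ℂ L a) - algebraMap ℂ L κ]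
  have hw : AlgebraicIndependent ℂ w := by
    apply algebraicIndependent_of_isAlgebraic hu
    set R := Algebra.adjoin ℂ (Set.range w)
    have h0 : w 0 ∈ R := Algebra.subset_adjoin ⟨0, rfl⟩
    have h1 : w 1 ∈ R := Algebra.subset_adjoin ⟨1, rfl⟩
    have e0 : u 0 = w 0 + algebraMap ℂ L a := by simp [w]
    have e1 : u 1 = w 0 * (w 1 + algebraMap ℂ L κ) + algebraMap ℂ L b := by
      simp only [w, Matrix.cons_val_zero, Matrix.cons_val_one, sub_add_cancel]
      field_simp
      ring
    rw [Fin.forall_fin_two]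
    constructor
    · have : u 0 ∈ R := e0 ▸ R.add_mem h0 (R.algebraMap_mem a)
      exact isAlgebraic_algebraMap (⟨_, this⟩ : R)
    · have : u 1 ∈ R := e1 ▸ R.add_mem (R.mul_mem h0 (R.add_mem h1 (R.algebraMap_mem κ)))
        (R.algebraMap_mem b)
      exact isAlgebraic_algebraMap (⟨_, this⟩ : R)
  obtain ⟨A, hA, hwA⟩ := exists_valuationSubring_of_algebraicIndependent hw
  let α : ℂ →+* A := (algebraMap ℂ L).codRestrict A hA
  have hα : ∀ c, (α c : L) = algebraMap ℂ L c := fun c => rfl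
  let t : A := ⟨w 0, (A.valuation_le_one_iff _).1 (hwA 0).le⟩
  let r : A := ⟨w 1, (A.valuation_le_one_iff _).1 (hwA 1).le⟩
  have ht : residue A t = 0 := by
    rw [residue_eq_zero_iff, ValuationSubring.valuation_lt_one_iff]; exact hwA 0
  have hr : residue A r = 0 := by
    rw [residue_eq_zero_iff, ValuationSubring.valuation_lt_one_iff]; exact hwA 1
  have htL : (t : L) ≠ 0 := hne
  let β : ℂ →+* ResidueField A := (residue A).comp α
  have hβ : ∀ c, residue A (α c) = β c := fun c => rfl
  let P : A → A → Fin 2 → L := fun X Y => ![((α a + t * X : A) : L), (α b + t * Y : A)]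
  have hP0 : ∀ X Y j, P X Y j ≠ 0 := fun X Y =>
    Fin.forall_fin_two.2 ⟨add_infinitesimal_ne_zero α ha ht X, add_infinitesimal_ne_zero α hb ht Y⟩
  -- The n-th point is (a, b) + t (X, Y) with (X, Y) reducing to l^n (1, κ); the generic point is
  -- the case n = 0, with t = u 0 - a.
  have key : ∀ n : ℕ, ∃ X Y : A, P X Y ∈ orbitOf S u ∧ residue A X = β (l ^ n) ∧
      residue A Y = β (κ * l ^ n) := by
    intro n
    induction n with
    | zero =>
      refine ⟨1, α κ + r, ?_, by simp, by simp [hr, hβ]⟩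
      have : P 1 (α κ + r) = u := by
        funext j
        fin_cases j
        · simp [P, hα, t, w]
        · simp only [P, hα, t, r, w, Fin.mk_one, Matrix.cons_val_one, Matrix.cons_val_zero,
            AddMemClass.coe_add, MulMemClass.coe_mul, add_sub_cancel]
          field_simp
          ring
      rw [this]
      exact Relation.ReflTransGen.refl
    | succ n ih =>
      obtain ⟨X, Y, hXY, hX, hY⟩ := ih
      obtain ⟨Y', hY', hS⟩ := hV A α t X Y (α (κ₂ * l ^ n)) ht (by
        simp only [map_add, map_mul, hX, hY, hβ]
        rw [← map_mul, ← map_mul, ← map_mul, ← map_add, ← map_mul, ← map_add, map_eq_zero]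
        linear_combination l ^ n * hv)
      obtain ⟨X', hX', hS'⟩ := hH A α t X Y' (α (l ^ (n + 1))) ht (by
        rw [hβ] at hY'
        simp only [map_add, map_mul, hX, hY', hβ]
        rw [← map_mul, ← map_mul, ← map_add, ← map_mul, ← map_add, map_eq_zero]
        linear_combination l ^ n * hh)
      rw [hβ] at hX' hY'
      refine ⟨X', Y', ?_, hX', ?_⟩
      · refine mem_orbitOf_trans (mem_orbitOf_trans hXY ?_)
          (mem_orbitOf_of_eq 0 (hP0 X Y') (hP0 X' Y') ?_ hS')
        · refine mem_orbitOf_of_eq 1 (hP0 X Y) (hP0 X Y') ?_ hS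
          intro j hj
          obtain rfl : j = 0 := by omega
          rfl
        · intro j hj
          obtain rfl : j = 1 := by omega
          rfl
      · rw [hY', ← hlκ]
        congr 1
        ring
  choose X Y hXY hX hY using key
  refine Set.infinite_of_injective_forall_mem (f := fun n => P (X n) (Y n)) ?_ hXY
  intro n m hnm
  have h0 : ((α a + t * X n : A) : L) = (α a + t * X m : A) := congrFun hnm 0
  have h1 : X n = X m := by
    apply Subtype.val_injective
    push_cast at h0
    exact mul_left_cancel₀ htL (add_left_cancel h0)
  have h2 : l ^ n = l ^ m := β.injective (by rw [← hX, ← hX, h1])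
  have h3 : ‖l‖ ^ n = ‖l‖ ^ m := by rw [← norm_pow, ← norm_pow, h2]
  exact pow_right_injective₀ (norm_pos_iff.2 hl0) hl1 h3

end Critical


/-! ### Complex critical points for the four remaining models. -/

section CriticalModels

open IsLocalRing

variable {L : Type*} [Field L] [IsAlgClosed L] [Algebra ℂ L] {S : Finset (Fin 2 → ℤ)}
  {u : Fin 2 → L}

/-- The common treatment of two step sets: those with step polynomial
`x⁻² (1 + y⁻²) + w x⁻¹ (1 + y⁻¹) + x (1 + y)` for `w = 0` and `w = 1`. -/
theorem infinite_orbitOf_of_cubic_family (hu : IsTranscendenceBasis ℂ u) {w : ℕ} {a b : ℂ}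
    (hV : ∀ x y Y : L, x ≠ 0 → y ≠ 0 → Y ≠ 0 →
      x ^ 3 * y ^ 2 * Y ^ 2 - Y - y - w * x * y * Y = 0 → stepPoly S ![x, y] = stepPoly S ![x, Y])
    (hH : ∀ x X y : L, x ≠ 0 → X ≠ 0 → y ≠ 0 →
      (1 + y) * y ^ 2 * X ^ 2 * x ^ 2 - (X + x) * (1 + y ^ 2) - w * x * X * (y ^ 2 + y) = 0 →
        stepPoly S ![x, y] = stepPoly S ![X, y])
    (ha : a ^ 3 = w * a + 2) (hb : a ^ 3 * (b ^ 2 + b) + 2 = 0) (hre : b.re = -1 / 2)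
    (him : b.im ≠ 0) : (orbitOf S u).Infinite := by
  have hbr : ∀ c : ℝ, b ≠ c := by rintro c rfl; simp at him
  have hb0 : b ≠ 0 := by simpa using hbr 0
  have hb1 : b - 1 ≠ 0 := sub_ne_zero.2 (by simpa using hbr 1)
  have hb2 : b + 1 ≠ 0 := by
    intro h; apply hbr (-1); push_cast; linear_combination h
  have hb3 : 1 + 2 * b ≠ 0 := by
    intro h; apply hbr (-1 / 2); push_cast; linear_combination h / 2
  have ha0 : a ≠ 0 := by rintro rfl; norm_num at hb
  have hbb : b ^ 2 + b ≠ 0 := by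
    rw [show b ^ 2 + b = b * (b + 1) by ring]; exact mul_ne_zero hb0 hb2
  -- The partial derivatives, at the critical point, of the divided differences of S that appear in
  -- `hV` (for p, q) and `hH` (for p', q').
  obtain ⟨p, hp⟩ : ∃ p, p = 3 * a ^ 2 * b ^ 4 - w * b ^ 2 := ⟨_, rfl⟩
  obtain ⟨q, hq⟩ : ∃ q, q = 2 * a ^ 3 * b ^ 3 - 1 - w * a * b := ⟨_, rfl⟩
  obtain ⟨p', hp'⟩ : ∃ p', p' = a ^ 4 * (2 * b + 3 * b ^ 2) - 4 * a * b -
    w * a ^ 2 * (2 * b + 1) := ⟨_, rfl⟩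
  obtain ⟨q', hq'⟩ : ∃ q', q' = 2 * a ^ 3 * ((1 + b) * b ^ 2) - (1 + b ^ 2) -
    w * a * (b ^ 2 + b) := ⟨_, rfl⟩
  have hwa : w * a = a ^ 3 - 2 := by linear_combination -ha
  have hab : a ^ 3 * b ^ 3 = 2 + w * a * b := by
    rw [hwa]; linear_combination (b - 1) * hb
  have ep : a * p = 2 * b * q := by
    rw [hp, hq]; linear_combination -b * hab
  have eq₁ : (1 + b) * q = (1 - b) * (1 + 2 * b) := by
    rw [hq]
    linear_combination 2 * (1 + b) * hab + (1 + b) * b * hwa + hb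
  have ep' : (b ^ 2 + b) * p' = 2 * a * (1 - b) * (1 + 2 * b) := by
    rw [hp']
    linear_combination (a * (3 * b ^ 2 - 1)) * hb - a * (2 * b + 1) * (b ^ 2 + b) * hwa
  have eq₂ : q' = (b - 1) ^ 2 := by
    rw [hq']
    linear_combination (2 * b - 1) * hb - (b ^ 2 + b) * hwa
  have hq0 : q ≠ 0 := by
    intro h
    rw [h, mul_zero] at eq₁
    exact mul_ne_zero (sub_ne_zero.2 (sub_ne_zero.1 hb1).symm) hb3 eq₁.symm
  have hq'0 : q' ≠ 0 := by rw [eq₂]; exact pow_ne_zero _ hb1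
  have hτ : (p * p' / (q * q')).im ≠ 0 := by
    intro h0
    obtain ⟨r, hr⟩ : ∃ r : ℝ, p * p' / (q * q') = r :=
      ⟨(p * p' / (q * q')).re, Complex.ext rfl (by simpa using h0)⟩
    rw [div_eq_iff (mul_ne_zero hq0 hq'0)] at hr
    -- Since Re b = -1/2, the left side is purely imaginary, whereas 1 - b² has real part 3/4 + (Im
    -- b)². A real r must then be 0, contradicting Im b ≠ 0.
    have h1 : 4 * (1 + 2 * b) = r * (1 - b ^ 2) := by
      apply mul_left_cancel₀ (mul_ne_zero (mul_ne_zero ha0 hbb) (mul_ne_zero hq0 hb1))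
      have : a * (b ^ 2 + b) * (p * p') = a * (b ^ 2 + b) * (r * (q * q')) := by rw [hr]
      have h2 : a * (b ^ 2 + b) * (p * p') = 2 * b * q * (2 * a * (1 - b) * (1 + 2 * b)) := by
        rw [← ep, ← ep']; ring
      rw [h2, eq₂] at this
      linear_combination -(b + 1) * this
    have hre1 := congrArg Complex.re h1
    have him1 := congrArg Complex.im h1
    simp only [pow_two, Complex.mul_re, Complex.mul_im, Complex.add_re, Complex.add_im,
      Complex.sub_re, Complex.sub_im, Complex.one_re, Complex.one_im, Complex.re_ofNat,
      Complex.im_ofNat, Complex.ofReal_re, Complex.ofReal_im, hre] at hre1 him1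
    have hr0 : r * (3 / 4 + b.im ^ 2) = 0 := by linarith
    have hr1 : r = 0 := (mul_eq_zero.1 hr0).resolve_right (by positivity)
    rw [hr1] at him1
    apply him
    linarith
  refine infinite_orbitOf_of_critical hu ha0 hb0 hq0 hq'0 hτ ?_ ?_
  · intro A α t X Y Z ht hZ
    have n2 : residue A 2 = 2 := map_ofNat (residue A) 2
    have n3 : residue A 3 = 3 := map_ofNat (residue A) 3
    have m2 : α 2 = 2 := map_ofNat α 2
    have m3 : α 3 = 3 := map_ofNat α 3
    -- k is (x³ - a³) / (tX). The coefficients below come from inserting Y = b + tW in the divided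
    -- difference: it vanishes at the critical point (`hE`), so a factor t comes out.
    let k : A := 3 * α a ^ 2 + 3 * α a * t * X + t ^ 2 * X ^ 2
    let x : A := α a + t * X
    let y : A := α b + t * Y
    obtain ⟨W, hW, hWZ⟩ := exists_root_of_linear_residue (c₂ := x ^ 3 * y ^ 2)
      (c₁ := 2 * α b * x ^ 3 * y ^ 2 - 1 - (w : A) * x * y)
      (c₀ := α b ^ 2 * (X * k * y ^ 2 + α a ^ 3 * Y * (2 * α b + t * Y)) - Y -
        (w : A) * α b * (X * y + α a * Y)) (z := Z) ht
      (by
        have : residue A (2 * α b * x ^ 3 * y ^ 2 - 1 - (w : A) * x * y) = residue A (α q) := by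
          simp [x, y, hq, ht, n2, m2]; ring
        rw [this]
        exact fun h => hq0 ((map_eq_zero ((residue A).comp α)).1 h))
      (by
        rw [← hZ]
        simp [x, y, k, hq, hp, ht, n2, n3, m2, m3]
        ring)
    refine ⟨W, hWZ, hV _ _ _ (add_infinitesimal_ne_zero α ha0 ht X) (add_infinitesimal_ne_zero α hb0 ht Y)
      (add_infinitesimal_ne_zero α hb0 ht W) ?_⟩
    have hE : α a ^ 3 * α b ^ 4 - 2 * α b - (w : A) * α a * α b ^ 2 = 0 := by
      have := congrArg α (show a ^ 3 * b ^ 4 - 2 * b - w * a * b ^ 2 = 0 by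
        linear_combination b * hab)
      simpa [m2] using this
    have h : x ^ 3 * y ^ 2 * (α b + t * W) ^ 2 - (α b + t * W) - y - (w : A) * x * y * (α b + t * W) =
        0 := by
      simp only [x, y, k] at hW ⊢
      linear_combination t * hW + hE
    exact_mod_cast congrArg Subtype.val h
  · intro A α t X Y Z ht hZ
    have n2 : residue A 2 = 2 := map_ofNat (residue A) 2
    have n3 : residue A 3 = 3 := map_ofNat (residue A) 3
    have m2 : α 2 = 2 := map_ofNat α 2
    have m3 : α 3 = 3 := map_ofNat α 3
    have m4 : α 4 = 4 := map_ofNat α 4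
    have n4 : residue A 4 = 4 := map_ofNat (residue A) 4
    let x : A := α a + t * X
    let y : A := α b + t * Y
    let g : A := 2 * α b + t * Y + 3 * α b ^ 2 + 3 * α b * t * Y + t ^ 2 * Y ^ 2
    obtain ⟨W, hW, hWZ⟩ := exists_root_of_linear_residue (c₂ := (1 + y) * y ^ 2 * x ^ 2)
      (c₁ := 2 * α a * (1 + y) * y ^ 2 * x ^ 2 - (1 + y ^ 2) - (w : A) * x * (y ^ 2 + y))
      (c₀ := α a ^ 2 * (g * Y * x ^ 2 + (1 + α b) * α b ^ 2 * X * (2 * α a + t * X)) -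
        (X * (1 + y ^ 2) + 2 * α a * Y * (2 * α b + t * Y)) -
        (w : A) * α a * (X * (y ^ 2 + y) + α a * Y * (2 * α b + t * Y + 1))) (z := Z) ht
      (by
        have : residue A (2 * α a * (1 + y) * y ^ 2 * x ^ 2 - (1 + y ^ 2) -
            (w : A) * x * (y ^ 2 + y)) = residue A (α q') := by
          simp [x, y, hq', ht, n2, m2]; ring
        rw [this]
        exact fun h => hq'0 ((map_eq_zero ((residue A).comp α)).1 h))
      (by
        rw [← hZ]
        simp [x, y, g, hq', hp', ht, n2, n3, n4, m2, m3, m4]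
        ring)
    refine ⟨W, hWZ, hH _ _ _ (add_infinitesimal_ne_zero α ha0 ht X) (add_infinitesimal_ne_zero α ha0 ht W)
      (add_infinitesimal_ne_zero α hb0 ht Y) ?_⟩
    have hE : (1 + α b) * α b ^ 2 * α a ^ 4 - 2 * α a * (1 + α b ^ 2) -
        (w : A) * α a ^ 2 * (α b ^ 2 + α b) = 0 := by
      have := congrArg α (show (1 + b) * b ^ 2 * a ^ 4 - 2 * a * (1 + b ^ 2) -
        w * a ^ 2 * (b ^ 2 + b) = 0 by
          linear_combination a * (b - 1) * hb - a * (b ^ 2 + b) * hwa)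
      simpa [m2] using this
    have h : (1 + y) * y ^ 2 * (α a + t * W) ^ 2 * x ^ 2 - ((α a + t * W) + x) * (1 + y ^ 2) -
        (w : A) * x * (α a + t * W) * (y ^ 2 + y) = 0 := by
      simp only [x, y, g] at hW ⊢
      linear_combination t * hW + hE
    exact_mod_cast congrArg Subtype.val h

end CriticalModels


section CriticalModels

open IsLocalRing

variable {L : Type*} [Field L] [IsAlgClosed L] [Algebra ℂ L] {u : Fin 2 → L}

theorem infinite_orbitOf_model_nine (hu : IsTranscendenceBasis ℂ u) :
    (orbitOf {![-2, -2], ![-2, 0], ![1, 0], ![1, 1]} u).Infinite := by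
  obtain ⟨a, ha⟩ := IsAlgClosed.exists_pow_nat_eq (2 : ℂ) (n := 3) (by norm_num)
  have h3 : √3 ^ 2 = (3 : ℝ) := Real.sq_sqrt (by norm_num)
  refine infinite_orbitOf_of_cubic_family (w := 0) (a := a) (b := ⟨-1 / 2, √3 / 2⟩) hu ?_ ?_
    (by simpa using ha) ?_ rfl (by simp)
  · intro x y Y hx hy hY h
    simp [stepPoly, Fin.prod_univ_two, zpow_neg]
    field_simp
    linear_combination (y - Y) * h
  · intro x X y hx hX hy h
    simp [stepPoly, Fin.prod_univ_two, zpow_neg]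
    field_simp
    linear_combination (x - X) * h
  · rw [ha]
    apply Complex.ext
    · simp [pow_two]
      linarith
    · simp [pow_two]
      ring

theorem infinite_orbitOf_model_ten (hu : IsTranscendenceBasis ℂ u) :
    (orbitOf {![-2, -2], ![-2, 0], ![-1, -1], ![-1, 0], ![1, 0], ![1, 1]} u).Infinite := by
  -- For a real with a ≤ 19/10 one has a³ = a + 2 < 8, so b² + b + 2/a³ has negative discriminant
  -- and nonreal roots of real part -1/2.
  obtain ⟨a, ha, ha3⟩ : ∃ a ∈ Set.Icc (1 : ℝ) (19 / 10), a ^ 3 - a = 2 :=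
    intermediate_value_Icc (by norm_num) (f := fun a : ℝ => a ^ 3 - a) (by fun_prop)
      (by norm_num)
  have ha0 : 0 < a ^ 3 := pow_pos (by linarith [ha.1]) 3
  have hpos : 0 < 2 / a ^ 3 - 1 / 4 := by
    rw [sub_pos, div_lt_div_iff₀ (by norm_num) ha0]
    linarith [ha.2]
  have hs := Real.sq_sqrt hpos.le
  refine infinite_orbitOf_of_cubic_family (w := 1) (a := a)
    (b := ⟨-1 / 2, √(2 / a ^ 3 - 1 / 4)⟩) hu ?_ ?_ ?_ ?_ rfl (Real.sqrt_pos.2 hpos).ne'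
  · intro x y Y hx hy hY h
    rw [Nat.cast_one] at h
    simp [stepPoly, Fin.prod_univ_two, zpow_neg]
    field_simp
    linear_combination (y - Y) * h
  · intro x X y hx hX hy h
    rw [Nat.cast_one] at h
    simp [stepPoly, Fin.prod_univ_two, zpow_neg]
    field_simp
    linear_combination (x - X) * h
  · norm_cast
    linarith
  · rw [← Complex.ofReal_pow]
    generalize √(2 / a ^ 3 - 1 / 4) = s at *
    have h2 : a ^ 3 * (s ^ 2 + 1 / 4) = 2 := by
      rw [hs, sub_add_cancel, mul_div_cancel₀ _ ha0.ne']
    apply Complex.ext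
    · simp only [pow_two, Complex.add_re, Complex.mul_re, Complex.ofReal_re, Complex.ofReal_im,
        Complex.add_im, Complex.mul_im, Complex.re_ofNat, Complex.zero_re]
      linarith
    · simp only [pow_two, Complex.add_re, Complex.mul_re, Complex.ofReal_re, Complex.ofReal_im,
        Complex.add_im, Complex.mul_im, Complex.im_ofNat, Complex.zero_im]
      ring

theorem exists_primitive_cube_root : ∃ a : ℂ, a ^ 2 + a + 1 = 0 ∧ a.im ≠ 0 := by
  have h3 : √3 ^ 2 = (3 : ℝ) := Real.sq_sqrt (by norm_num)
  refine ⟨⟨-1 / 2, √3 / 2⟩, ?_, by simp⟩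
  apply Complex.ext
  · simp [pow_two]
    linarith
  · simp [pow_two]
    ring

theorem infinite_orbitOf_model_eleven (hu : IsTranscendenceBasis ℂ u) :
    (orbitOf {![-2, -1], ![-1, -1], ![0, -1], ![0, 1], ![1, -1], ![1, 1]} u).Infinite := by
  obtain ⟨a, ha, him⟩ := exists_primitive_cube_root
  have ha3 : a ^ 3 = 1 := by linear_combination (a - 1) * ha
  have ha0 : a ≠ 0 := by rintro rfl; simp at him
  obtain ⟨b, hb⟩ : ∃ b, b = Complex.I * a := ⟨_, rfl⟩
  have hb0 : b ≠ 0 := by rw [hb]; exact mul_ne_zero Complex.I_ne_zero ha0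
  have hb2 : b ^ 2 = 1 + a := by
    rw [hb, mul_pow, Complex.I_sq]
    linear_combination -ha
  clear hb
  have h3a : 3 + a ≠ 0 := by
    intro h
    have := congrArg Complex.im h
    simp at this
    exact him this
  obtain ⟨p, hp⟩ : ∃ p, p = 2 * a * b ^ 2 - 2 * a := ⟨_, rfl⟩
  obtain ⟨q, hq⟩ : ∃ q, q = a ^ 2 * b := ⟨_, rfl⟩
  obtain ⟨p', hp'⟩ : ∃ p', p' = 2 * b * a ^ 4 := ⟨_, rfl⟩
  obtain ⟨q', hq'⟩ : ∃ q', q' = 2 * a ^ 3 * (b ^ 2 + 1) - 1 - a := ⟨_, rfl⟩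
  have eq₂ : q' = 3 + a := by rw [hq', ha3, hb2]; ring
  have hq0 : q ≠ 0 := by rw [hq]; exact mul_ne_zero (pow_ne_zero _ ha0) hb0
  have hq'0 : q' ≠ 0 := by rwa [eq₂]
  have hτ : (p * p' / (q * q')).im ≠ 0 := by
    intro h0
    obtain ⟨r, hr⟩ : ∃ r : ℝ, p * p' / (q * q') = r :=
      ⟨(p * p' / (q * q')).re, Complex.ext rfl (by simpa using h0)⟩
    rw [div_eq_iff (mul_ne_zero hq0 hq'0), eq₂, hp, hp', hq, hb2] at hr
    -- As a is not real, comparing imaginary parts gives r = 4, and then 12 = 0.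
    have h1 : 4 * a = r * (3 + a) := by
      apply mul_left_cancel₀ (mul_ne_zero (pow_ne_zero 2 ha0) hb0)
      linear_combination hr - 4 * a ^ 3 * b * ha3
    have h4 : r = 4 := by
      have := congrArg Complex.im h1
      simp at this
      exact (this.resolve_right him).symm
    rw [h4] at h1
    have h5 : (12 : ℂ) = 0 := by push_cast at h1; linear_combination -h1
    norm_num at h5
  refine infinite_orbitOf_of_critical hu ha0 hb0 hq0 hq'0 hτ ?_ ?_
  · intro A α t X Y Z ht hZ
    have n2 : residue A 2 = 2 := map_ofNat (residue A) 2
    have m2 : α 2 = 2 := map_ofNat α 2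
    let x : A := α a + t * X
    let y : A := α b + t * Y
    -- After cancelling 1 + x, the two roots in y satisfy y Y = 1 + x⁻², which is linear in Y; hence
    -- c₂ = 0.
    obtain ⟨W, hW, hWZ⟩ := exists_root_of_linear_residue (c₂ := 0) (c₁ := x ^ 2 * y)
      (c₀ := α b * (X * (2 * α a + t * X) * y + α a ^ 2 * Y) - X * (2 * α a + t * X)) (z := Z) ht
      (by
        have : residue A (x ^ 2 * y) = residue A (α q) := by simp [x, y, hq, ht]
        rw [this]
        exact fun h => hq0 ((map_eq_zero ((residue A).comp α)).1 h))
      (by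
        rw [← hZ]
        simp [x, y, hq, hp, ht, n2, m2]
        ring)
    refine ⟨W, hWZ, ?_⟩
    have hE : α a ^ 2 * α b ^ 2 - 1 - α a ^ 2 = 0 := by
      have := congrArg α (show a ^ 2 * b ^ 2 - 1 - a ^ 2 = 0 by
        linear_combination a ^ 2 * hb2 + ha3)
      simpa using this
    have h : x ^ 2 * y * (α b + t * W) - 1 - x ^ 2 = 0 := by
      simp only [x, y] at hW ⊢
      linear_combination t * hW + hE
    have hx := add_infinitesimal_ne_zero α ha0 ht X
    have hy := add_infinitesimal_ne_zero α hb0 ht Y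
    have hY := add_infinitesimal_ne_zero α hb0 ht W
    have h' : ((α a + t * X : A) : L) ^ 2 * (α b + t * Y : A) * (α b + t * W : A) - 1 -
      ((α a + t * X : A) : L) ^ 2 = 0 := by exact_mod_cast congrArg Subtype.val h
    generalize ((α a + t * X : A) : L) = x at *
    generalize ((α b + t * Y : A) : L) = y at *
    generalize ((α b + t * W : A) : L) = Y at *
    simp [stepPoly, Fin.prod_univ_two, zpow_neg]
    field_simp
    linear_combination (y - Y) * (1 + x) * h'
  · intro A α t X Y Z ht hZ
    have n2 : residue A 2 = 2 := map_ofNat (residue A) 2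
    have m2 : α 2 = 2 := map_ofNat α 2
    let x : A := α a + t * X
    let y : A := α b + t * Y
    obtain ⟨W, hW, hWZ⟩ := exists_root_of_linear_residue (c₂ := (y ^ 2 + 1) * x ^ 2)
      (c₁ := 2 * α a * (y ^ 2 + 1) * x ^ 2 - 1 - x)
      (c₀ := α a ^ 2 * (Y * (2 * α b + t * Y) * x ^ 2 + (α b ^ 2 + 1) * X * (2 * α a + t * X)) -
        X - α a * X) (z := Z) ht
      (by
        have : residue A (2 * α a * (y ^ 2 + 1) * x ^ 2 - 1 - x) = residue A (α q') := by
          simp [x, y, hq', ht, n2, m2]; ring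
        rw [this]
        exact fun h => hq'0 ((map_eq_zero ((residue A).comp α)).1 h))
      (by
        rw [← hZ]
        simp [x, y, hq', hp', ht, n2, m2]
        ring)
    refine ⟨W, hWZ, ?_⟩
    have hE : (α b ^ 2 + 1) * α a ^ 4 - 2 * α a - α a ^ 2 = 0 := by
      have := congrArg α (show (b ^ 2 + 1) * a ^ 4 - 2 * a - a ^ 2 = 0 by
        linear_combination a ^ 4 * hb2 + (2 + a) * a * ha3)
      simpa [m2] using this
    have h : (y ^ 2 + 1) * (α a + t * W) ^ 2 * x ^ 2 - ((α a + t * W) + x) - (α a + t * W) * x =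
        0 := by
      simp only [x, y] at hW ⊢
      linear_combination t * hW + hE
    have hx := add_infinitesimal_ne_zero α ha0 ht X
    have hy := add_infinitesimal_ne_zero α hb0 ht Y
    have hX := add_infinitesimal_ne_zero α ha0 ht W
    have h' : (((α b + t * Y : A) : L) ^ 2 + 1) * (α a + t * W : A) ^ 2 * (α a + t * X : A) ^ 2 -
      (((α a + t * W : A) : L) + (α a + t * X : A)) -
        ((α a + t * W : A) : L) * (α a + t * X : A) = 0 := by
      exact_mod_cast congrArg Subtype.val h
    generalize ((α a + t * X : A) : L) = x at *
    generalize ((α b + t * Y : A) : L) = y at *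
    generalize ((α a + t * W : A) : L) = X at *
    simp [stepPoly, Fin.prod_univ_two, zpow_neg]
    field_simp
    linear_combination (x - X) * h'

theorem infinite_orbitOf_model_twelve (hu : IsTranscendenceBasis ℂ u) :
    (orbitOf {![-2, 1], ![-1, 1], ![0, -1], ![0, 1], ![1, -1], ![1, 1]} u).Infinite := by
  obtain ⟨a, ha, him⟩ := exists_primitive_cube_root
  have ha3 : a ^ 3 = 1 := by linear_combination (a - 1) * ha
  have ha0 : a ≠ 0 := by rintro rfl; simp at him
  obtain ⟨b, hb⟩ : ∃ b, b = Complex.I * a ^ 2 := ⟨_, rfl⟩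
  have hb0 : b ≠ 0 := by rw [hb]; exact mul_ne_zero Complex.I_ne_zero (pow_ne_zero _ ha0)
  have hb2 : b ^ 2 = -a := by
    rw [hb, mul_pow, Complex.I_sq]
    linear_combination -a * ha3
  clear hb
  have h3a : 1 - 2 * a ≠ 0 := by
    intro h
    have := congrArg Complex.im h
    simp at this
    exact him this
  obtain ⟨p, hp⟩ : ∃ p, p = 2 * a * b ^ 2 - 2 * a := ⟨_, rfl⟩
  obtain ⟨q, hq⟩ : ∃ q, q = (1 + a ^ 2) * b := ⟨_, rfl⟩
  obtain ⟨p', hp'⟩ : ∃ p', p' = 2 * b * a ^ 4 - 4 * a * b - 2 * a ^ 2 * b := ⟨_, rfl⟩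
  obtain ⟨q', hq'⟩ : ∃ q', q' = 2 * a ^ 3 * (b ^ 2 + 1) - b ^ 2 - a * b ^ 2 := ⟨_, rfl⟩
  have eq₁ : q = -(a * b) := by rw [hq]; linear_combination b * ha
  have ep' : p' = 2 * b := by rw [hp']; linear_combination 2 * b * a * ha3 - 2 * b * ha
  have eq₂ : q' = 1 - 2 * a := by rw [hq', ha3, hb2]; linear_combination ha
  have hq0 : q ≠ 0 := by rw [eq₁]; exact neg_ne_zero.2 (mul_ne_zero ha0 hb0)
  have hq'0 : q' ≠ 0 := by rwa [eq₂]
  have hτ : (p * p' / (q * q')).im ≠ 0 := by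
    intro h0
    obtain ⟨r, hr⟩ : ∃ r : ℝ, p * p' / (q * q') = r :=
      ⟨(p * p' / (q * q')).re, Complex.ext rfl (by simpa using h0)⟩
    rw [div_eq_iff (mul_ne_zero hq0 hq'0), eq₂, hp, ep', eq₁, hb2] at hr
    have h1 : 4 * (1 + a) = r * (1 - 2 * a) := by
      apply mul_left_cancel₀ (mul_ne_zero ha0 hb0)
      linear_combination -hr
    have h2 : (4 + 2 * r) * a.im = 0 := by
      have := congrArg Complex.im h1
      simp at this
      linarith
    have h4 : r = -2 := by linarith [(mul_eq_zero.1 h2).resolve_right him]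
    rw [h4] at h1
    have h5 : (6 : ℂ) = 0 := by push_cast at h1; linear_combination h1
    norm_num at h5
  refine infinite_orbitOf_of_critical hu ha0 hb0 hq0 hq'0 hτ ?_ ?_
  · intro A α t X Y Z ht hZ
    have n2 : residue A 2 = 2 := map_ofNat (residue A) 2
    have m2 : α 2 = 2 := map_ofNat α 2
    let x : A := α a + t * X
    let y : A := α b + t * Y
    -- Here the relation between the two roots is (1 + x²) y Y = x².
    obtain ⟨W, hW, hWZ⟩ := exists_root_of_linear_residue (c₂ := 0) (c₁ := (1 + x ^ 2) * y)
      (c₀ := α b * (X * (2 * α a + t * X) * y + (1 + α a ^ 2) * Y) - X * (2 * α a + t * X))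
      (z := Z) ht
      (by
        have : residue A ((1 + x ^ 2) * y) = residue A (α q) := by simp [x, y, hq, ht]
        rw [this]
        exact fun h => hq0 ((map_eq_zero ((residue A).comp α)).1 h))
      (by
        rw [← hZ]
        simp [x, y, hq, hp, ht, n2, m2]
        ring)
    refine ⟨W, hWZ, ?_⟩
    have hE : (1 + α a ^ 2) * α b ^ 2 - α a ^ 2 = 0 := by
      have := congrArg α (show (1 + a ^ 2) * b ^ 2 - a ^ 2 = 0 by
        linear_combination (1 + a ^ 2) * hb2 - a * ha)
      simpa using this
    have h : (1 + x ^ 2) * y * (α b + t * W) - x ^ 2 = 0 := by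
      simp only [x, y] at hW ⊢
      linear_combination t * hW + hE
    have hx := add_infinitesimal_ne_zero α ha0 ht X
    have hy := add_infinitesimal_ne_zero α hb0 ht Y
    have hY := add_infinitesimal_ne_zero α hb0 ht W
    have h' : (1 + ((α a + t * X : A) : L) ^ 2) * (α b + t * Y : A) * (α b + t * W : A) -
      ((α a + t * X : A) : L) ^ 2 = 0 := by exact_mod_cast congrArg Subtype.val h
    generalize ((α a + t * X : A) : L) = x at *
    generalize ((α b + t * Y : A) : L) = y at *
    generalize ((α b + t * W : A) : L) = Y at *
    simp [stepPoly, Fin.prod_univ_two, zpow_neg]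
    field_simp
    linear_combination (y - Y) * (1 + x) * h'
  · intro A α t X Y Z ht hZ
    have n2 : residue A 2 = 2 := map_ofNat (residue A) 2
    have m2 : α 2 = 2 := map_ofNat α 2
    have m4 : α 4 = 4 := map_ofNat α 4
    have n4 : residue A 4 = 4 := map_ofNat (residue A) 4
    let x : A := α a + t * X
    let y : A := α b + t * Y
    let d : A := Y * (2 * α b + t * Y)
    obtain ⟨W, hW, hWZ⟩ := exists_root_of_linear_residue (c₂ := (y ^ 2 + 1) * x ^ 2)
      (c₁ := 2 * α a * (y ^ 2 + 1) * x ^ 2 - y ^ 2 - y ^ 2 * x)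
      (c₀ := α a ^ 2 * (d * x ^ 2 + (α b ^ 2 + 1) * X * (2 * α a + t * X)) -
        (d * (α a + x) + α b ^ 2 * X) - α a * (d * x + α b ^ 2 * X)) (z := Z) ht
      (by
        have : residue A (2 * α a * (y ^ 2 + 1) * x ^ 2 - y ^ 2 - y ^ 2 * x) =
            residue A (α q') := by
          simp [x, y, hq', ht, n2, m2]; ring
        rw [this]
        exact fun h => hq'0 ((map_eq_zero ((residue A).comp α)).1 h))
      (by
        rw [← hZ]
        simp [x, y, d, hq', hp', ht, n2, m2, n4, m4]
        ring)
    refine ⟨W, hWZ, ?_⟩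
    have hE : (α b ^ 2 + 1) * α a ^ 4 - 2 * α b ^ 2 * α a - α b ^ 2 * α a ^ 2 = 0 := by
      have := congrArg α (show (b ^ 2 + 1) * a ^ 4 - 2 * b ^ 2 * a - b ^ 2 * a ^ 2 = 0 by
        linear_combination (a ^ 4 - 2 * a - a ^ 2) * hb2 + (a - a ^ 2) * ha3 + a * ha)
      simpa [m2] using this
    have h : (y ^ 2 + 1) * (α a + t * W) ^ 2 * x ^ 2 - y ^ 2 * ((α a + t * W) + x) -
        y ^ 2 * (α a + t * W) * x = 0 := by
      simp only [x, y, d] at hW ⊢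
      linear_combination t * hW + hE
    have hx := add_infinitesimal_ne_zero α ha0 ht X
    have hy := add_infinitesimal_ne_zero α hb0 ht Y
    have hX := add_infinitesimal_ne_zero α ha0 ht W
    have h' : (((α b + t * Y : A) : L) ^ 2 + 1) * (α a + t * W : A) ^ 2 * (α a + t * X : A) ^ 2 -
      ((α b + t * Y : A) : L) ^ 2 * (((α a + t * W : A) : L) + (α a + t * X : A)) -
        ((α b + t * Y : A) : L) ^ 2 * (α a + t * W : A) * (α a + t * X : A) = 0 := by
      exact_mod_cast congrArg Subtype.val h
    generalize ((α a + t * X : A) : L) = x at *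
    generalize ((α b + t * Y : A) : L) = y at *
    generalize ((α a + t * W : A) : L) = X at *
    simp [stepPoly, Fin.prod_univ_two, zpow_neg]
    field_simp
    linear_combination (x - X) * h'

end CriticalModels


/-! ### Assembly, and the generic point as a transcendence basis. -/

theorem hasExcursionExponent_sixteenModels (k : Fin 16) :
    HasExcursionExponent (sixteenModels k) (sixteenExponents k : ℝ) := by
  have h : ∀ {S : Finset (Fin 2 → ℤ)} {α : ℝ} (β : ℚ), HasExcursionExponent S α → α = β →
      HasExcursionExponent S (β : ℝ) := fun β hS hα => hα ▸ hS
  fin_cases k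
  · exact h (-5) hasExcursionExponent_model_one (by norm_num)
  · exact h (-4) hasExcursionExponent_model_two (by norm_num)
  · exact h (-7) hasExcursionExponent_model_three (by norm_num)
  · exact h (-5) hasExcursionExponent_model_four (by norm_num)
  · exact h (-7 / 3) hasExcursionExponent_model_five (by norm_num)
  · exact h (-11 / 5) hasExcursionExponent_model_six (by norm_num)
  · exact h (-7) hasExcursionExponent_model_seven (by norm_num)
  · exact h (-11 / 5) hasExcursionExponent_model_eight (by norm_num)
  · exact h (-7 / 3) hasExcursionExponent_model_nine (by norm_num)
  · exact h (-7 / 3) hasExcursionExponent_model_ten (by norm_num)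
  · exact h (-5 / 2) hasExcursionExponent_model_eleven (by norm_num)
  · exact h (-4) hasExcursionExponent_model_twelve (by norm_num)
  · exact h (-4) hasExcursionExponent_model_thirteen (by norm_num)
  · exact h (-4) hasExcursionExponent_model_fourteen (by norm_num)
  · exact h (-3) hasExcursionExponent_model_fifteen (by norm_num)
  · exact h (-4) hasExcursionExponent_model_sixteen (by norm_num)

theorem infinite_orbitOf_sixteenModels {L : Type*} [Field L] [IsAlgClosed L] [Algebra ℂ L]
    {u : Fin 2 → L} (hu : IsTranscendenceBasis ℂ u) (k : Fin 16) :
    (orbitOf (sixteenModels k) u).Infinite := by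
  fin_cases k
  · exact infinite_orbitOf_model_one hu
  · exact infinite_orbitOf_model_two hu
  · exact infinite_orbitOf_model_three hu
  · exact infinite_orbitOf_model_four hu
  · exact infinite_orbitOf_model_five hu
  · exact infinite_orbitOf_model_six hu
  · exact infinite_orbitOf_model_seven hu
  · exact infinite_orbitOf_model_eight hu
  · exact infinite_orbitOf_model_nine hu
  · exact infinite_orbitOf_model_ten hu
  · exact infinite_orbitOf_model_eleven hu
  · exact infinite_orbitOf_model_twelve hu
  · exact infinite_orbitOf_model_thirteen hu
  · exact infinite_orbitOf_model_fourteen hu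
  · exact infinite_orbitOf_model_fifteen hu
  · exact infinite_orbitOf_model_sixteen hu

/-- The indeterminates are a transcendence basis of the polynomial ring, over which `L` is algebraic
by way of the fraction field. -/
theorem isTranscendenceBasis_genericPoint {d : ℕ} (L : Type*) [Field L]
    [Algebra (RationalFunctions d) L] [Algebra ℂ L] [IsScalarTower ℂ (RationalFunctions d) L]
    [Algebra.IsAlgebraic (RationalFunctions d) L] :
    IsTranscendenceBasis ℂ (genericPoint d L) := by
  let f : MvPolynomial (Fin d) ℂ →ₐ[ℂ] L :=
    (IsScalarTower.toAlgHom ℂ (RationalFunctions d) L).comp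
      (IsScalarTower.toAlgHom ℂ (MvPolynomial (Fin d) ℂ) (RationalFunctions d))
  have hf : Function.Injective f :=
    (algebraMap (RationalFunctions d) L).injective.comp (IsFractionRing.injective _ _)
  let _ : Algebra (MvPolynomial (Fin d) ℂ) L := f.toRingHom.toAlgebra
  have : IsScalarTower ℂ (MvPolynomial (Fin d) ℂ) L :=
    IsScalarTower.of_algebraMap_eq fun c => (f.commutes c).symm
  have : IsScalarTower (MvPolynomial (Fin d) ℂ) (RationalFunctions d) L :=
    IsScalarTower.of_algebraMap_eq fun _ => rfl
  have : FaithfulSMul (MvPolynomial (Fin d) ℂ) L := (faithfulSMul_iff_algebraMap_injective _ _).2 hf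
  have : Algebra.IsAlgebraic (MvPolynomial (Fin d) ℂ) (RationalFunctions d) :=
    IsLocalization.isAlgebraic _ (nonZeroDivisors _)
  have : Algebra.IsAlgebraic (MvPolynomial (Fin d) ℂ) L :=
    Algebra.IsAlgebraic.trans _ (RationalFunctions d) _
  exact (IsTranscendenceBasis.mvPolynomial (Fin d) ℂ).algebraMap_comp (A := L)

end LatticeWalk

theorem mainTheorem10 (k : Fin 16) :
    LatticeWalk.HasExcursionExponent (LatticeWalk.sixteenModels k)
      (LatticeWalk.sixteenExponents k : ℝ) ∧
    ∀ (L : Type*) [Field L] [Algebra (LatticeWalk.RationalFunctions 2) L]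
      [IsAlgClosure (LatticeWalk.RationalFunctions 2) L],
      (LatticeWalk.orbitOf (LatticeWalk.sixteenModels k)
        (LatticeWalk.genericPoint 2 L)).Infinite := by
  refine ⟨LatticeWalk.hasExcursionExponent_sixteenModels k, fun L _ _ _ => ?_⟩
  -- `L` comes only as an extension of ℂ(x, y); its structure over ℂ is obtained by composition.
  let _ : Algebra ℂ L :=
    ((algebraMap (LatticeWalk.RationalFunctions 2) L).comp
      (algebraMap ℂ (LatticeWalk.RationalFunctions 2))).toAlgebra
  have : IsScalarTower ℂ (LatticeWalk.RationalFunctions 2) L :=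
    IsScalarTower.of_algebraMap_eq fun _ => rfl
  have : IsAlgClosed L := IsAlgClosure.isAlgClosed (LatticeWalk.RationalFunctions 2)
  exact LatticeWalk.infinite_orbitOf_sixteenModels
    (LatticeWalk.isTranscendenceBasis_genericPoint L) k
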